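/- Let $G$ be a finite simple $3$-connected planar graph with a planar (combinatorial) embedding, i.e. a rotation system for which $|V|-|E|+|F|=2$; its faces are the orbits of face tracing. Let $T$ be a spanning tree of $G$. For a non-tree edge $e\in E(G)\setminus E(T)$ let $C(e)$ be the fundamental cycle of $e$, that is, the unique cycle of $T\cup e$. Let $e_0$ be a non-tree edge such that $C(e_0)$ is the boundary of a face $f_0$, and take $f_0$ as the outer face. A face lies inside a cycle $C$ if it cannot be reached from $f_0$ by passing from face to face across edges not on $C$. The bridges of a cycle $C$ are the connected components $X$ of $G\setminus C$ (each together with the edges between $X$ and $C$; its points of attachment are the vertices of $C$ adjacent to $X$) and the chords of $C$ (whose points of attachment are their two ends). Two distinct bridges conflict if they have points of attachment $a_1,a_1'$ and $a_2,a_2'$, respectively, that occur in the cyclic order $a_1,a_2,a_1',a_2'$ along $C$, or if they have three common points of attachment. The conflict graph $H_C(G)$ has the bridges of $C$ as vertices and the conflicting pairs as edges. For distinct non-tree edges $e_1,e_2$ write $e_1\prec e_2$ if, in a $2$-colouring of $H_{C(e_2)}(G)$, the bridges of $C(e_2)$ containing $e_0$ and $e_1$ get different colours. In particular $e_1\prec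 e_0$ never holds, as $e_0$ lies on $C(e_0)$. For a non-tree edge $e\ne e_0$ let $P(e)$ be the set of non-tree edges $e'\neq e$ such that $e'\prec e$ and there is no $e''$ with $e'\prec e''\prec e$, and let $$F(e)=\bigoplus_{e'\in P(e)\cup\{e\}} C(e')$$ be the $\mathbb{Z}_2$-sum (symmetric difference) of edge sets. Then for each non-tree edge $e\neq e_0$ there is exactly one face $f(e)$ that is adjacent to $e$ and lies inside $C(e)$, and the set of edges of $f(e)$ is exactly $F(e)$. This gives an explicit change of basis of the cycle space of $G$ over $\mathbb{Z}_2$: both the family of all fundamental cycles $C(e)$, $e\in E(G)\setminus E(T)$, and the family consisting of the outer face $C(e_0)$ and the faces $F(e)$, $e\in E(G)\setminus E(T)$, $e\ne e_0$, are bases of the cycle space. -/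

import Mathlib

namespace PlanarBasis

/-- A graph is 3-connected if it has more than three vertices and the removal of at most two
vertices never disconnects it. -/
def ThreeConnected {V : Type*} [Fintype V] (G : SimpleGraph V) : Prop :=
  3 < Fintype.card V ∧
    ∀ S : Finset V, S.card < 3 → (G.induce {v : V | v ∉ S}).Connected

/-! ### Combinatorial embeddings -/

/-- A combinatorial embedding (rotation system) of a graph: for every vertex, a cyclic ordering of
the darts (oriented edges) that leave this vertex, given as one permutation of all darts. -/
structure Embedding {V : Type*} (G : SimpleGraph V) where
  /-- the next dart in the cyclic ordering around the source of a dart -/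
  rot : Equiv.Perm G.Dart
  /-- the rotation keeps the source of a dart -/
  rot_fst : ∀ d : G.Dart, (rot d).fst = d.fst
  /-- the darts leaving a vertex form a single cycle of the rotation -/
  rot_cyclic : ∀ d d' : G.Dart, d.fst = d'.fst → rot.SameCycle d d'

namespace Embedding

variable {V : Type*} {G : SimpleGraph V} (M : Embedding G)

/-- Face tracing: after the dart `u → v` comes the successor of `v → u` in the rotation at `v`. -/
def facePerm : Equiv.Perm G.Dart :=
  (SimpleGraph.Dart.symm_involutive (G := G)).toPerm.trans M.rot

/-- The faces are the orbits of face tracing. -/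
def Face : Type _ := Quotient (Equiv.Perm.SameCycle.setoid M.facePerm)

/-- The face on the side of a dart. The two sides of an edge are the faces of its two darts. -/
def faceOf (d : G.Dart) : M.Face := Quotient.mk (Equiv.Perm.SameCycle.setoid M.facePerm) d

/-- The set of edges on the boundary of a face. -/
def faceEdges (f : M.Face) : Set (Sym2 V) := {x | ∃ d : G.Dart, M.faceOf d = f ∧ d.edge = x}

/-- A combinatorial embedding of a finite connected graph is planar if Euler's formula
`|V| - |E| + |F| = 2` holds. -/
def Planar : Prop := (Nat.card V : ℤ) - Nat.card G.edgeSet + Nat.card M.Face = 2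

/-- The face `f` lies inside the cycle with edge set `C`, where `f₀` is the outer face: one cannot
get from `f₀` to `f` by passing from face to face across edges that are not on the cycle. -/
def Inside (f₀ : M.Face) (C : Set (Sym2 V)) (f : M.Face) : Prop :=
  ¬ Relation.ReflTransGen
    (fun g h : M.Face => ∃ d : G.Dart, d.edge ∉ C ∧ M.faceOf d = g ∧ M.faceOf d.symm = h) f₀ f

end Embedding

/-! ### Bridges of a cycle and the conflict graph -/

section Bridges

variable {V : Type*} {G : SimpleGraph V} {u : V}

/-- The bridges of a cycle `C`: the connected components of `G \ C` (each of them stands for the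
component with its edges to `C`), and the chords of `C`. -/
def Bridge (C : G.Walk u u) : Type _ :=
  (G.induce {v : V | v ∉ C.support}).ConnectedComponent ⊕
    {x : Sym2 V // x ∈ G.edgeSet ∧ x ∉ C.edges ∧ ∀ v ∈ x, v ∈ C.support}

/-- The points of attachment of a bridge: the vertices of `C` adjacent to the component, or the
two ends of the chord. -/
def Bridge.attachments {C : G.Walk u u} : Bridge C → Set V
  | Sum.inl X => {a | a ∈ C.support ∧
      ∃ v : {v : V | v ∉ C.support}, (G.induce _).connectedComponentMk v = X ∧ G.Adj v a}
  | Sum.inr x => {a | a ∈ x.1}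

/-- The edges of a bridge: the edges with at least one end in the component, or the chord. -/
def Bridge.edges {C : G.Walk u u} : Bridge C → Set (Sym2 V)
  | Sum.inl X => {x | x ∈ G.edgeSet ∧
      ∃ v : {v : V | v ∉ C.support}, (G.induce _).connectedComponentMk v = X ∧ (v : V) ∈ x}
  | Sum.inr x => {x.1}

/-- Walking once along `C` from its base vertex, one meets points of `A`, `B`, `A`, `B` in this
order. (The positions `0, …, C.length - 1` list every vertex of a cycle exactly once.) -/
def Interleave (C : G.Walk u u) (A B : Set V) : Prop :=
  ∃ i j k l : ℕ, i < j ∧ j < k ∧ k < l ∧ l < C.length ∧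
    C.getVert i ∈ A ∧ C.getVert j ∈ B ∧ C.getVert k ∈ A ∧ C.getVert l ∈ B

/-- Two bridges conflict if some points of attachment `a₁, a₁'` of the first and `a₂, a₂'` of the
second occur in the cyclic order `a₁, a₂, a₁', a₂'` along `C` (read from the base vertex of `C`, such
an order starts with a point of either bridge), or if they have three common points of
attachment. -/
def Conflict (C : G.Walk u u) (B₁ B₂ : Bridge C) : Prop :=
  Interleave C B₁.attachments B₂.attachments ∨ Interleave C B₂.attachments B₁.attachments ∨
    ∃ a b c : V, a ≠ b ∧ a ≠ c ∧ b ≠ c ∧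
      ({a, b, c} : Set V) ⊆ B₁.attachments ∩ B₂.attachments

/-- The conflict graph of a cycle: its vertices are the bridges, its edges the conflicts between
distinct bridges. -/
def conflictGraph (C : G.Walk u u) : SimpleGraph (Bridge C) where
  Adj B₁ B₂ := B₁ ≠ B₂ ∧ Conflict C B₁ B₂
  symm := ⟨fun _ _ h => ⟨h.1.symm, by
    rcases h.2 with h | h | ⟨a, b, c, hab, hac, hbc, h⟩
    · exact Or.inr (Or.inl h)
    · exact Or.inl h
    · exact Or.inr (Or.inr ⟨a, b, c, hab, hac, hbc, fun x hx => ⟨(h hx).2, (h hx).1⟩⟩)⟩⟩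
  loopless := ⟨fun _ h => h.1 rfl⟩

end Bridges

/-! ### Fundamental cycles and the enclosure order -/

section Fundamental

variable {V : Type*} (G T : SimpleGraph V)

/-- `e` is an edge of `G` that is not in the spanning tree `T`. -/
def NonTree (e : Sym2 V) : Prop := e ∈ G.edgeSet ∧ e ∉ T.edgeSet

/-- `C` is the cycle of `T ∪ e`, traversed from some vertex in some direction. -/
def IsFundCycle {G : SimpleGraph V} (T : SimpleGraph V) (e : Sym2 V) {u : V} (C : G.Walk u u) :
    Prop :=
  C.IsCycle ∧ ∀ x ∈ C.edges, x ∈ T.edgeSet ∨ x = e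

/-- The edge set of the fundamental cycle `C(e)`. -/
def fundCycle (e : Sym2 V) : Set (Sym2 V) :=
  {x | ∃ (u : V) (C : G.Walk u u), IsFundCycle T e C ∧ x ∈ C.edges}

/-- The enclosure order `e₁ ≺ e₂` on non-tree edges: in a 2-colouring of the conflict graph of
`C(e₂)`, the bridges that contain `e₀` and `e₁` get different colours. -/
def Prec (e₀ e₁ e₂ : Sym2 V) : Prop :=
  NonTree G T e₁ ∧ NonTree G T e₂ ∧ e₁ ≠ e₂ ∧
    ∃ (u : V) (C : G.Walk u u), IsFundCycle T e₂ C ∧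
      ∃ (c : (conflictGraph C).Coloring (Fin 2)) (B₀ B₁ : Bridge C),
        e₀ ∈ B₀.edges ∧ e₁ ∈ B₁.edges ∧ c B₀ ≠ c B₁

/-- The set `P(e)` of immediate predecessors of `e` in the enclosure order. -/
def predecessors (e₀ e : Sym2 V) : Set (Sym2 V) :=
  {e' | NonTree G T e' ∧ e' ≠ e ∧ Prec G T e₀ e' e ∧
    ¬ ∃ e'' : Sym2 V, Prec G T e₀ e' e'' ∧ Prec G T e₀ e'' e}

/-- A set of edges as a vector over `ℤ/2`; sums of vectors are symmetric differences of sets. -/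
noncomputable def vec (S : Set (Sym2 V)) : Sym2 V → ZMod 2 := S.indicator 1

open Classical in
/-- `F(e)`: the sum over `ℤ/2` of the fundamental cycles `C(e')`, for `e'` in `P(e) ∪ {e}`. -/
noncomputable def cycleSum [Fintype V] (e₀ e : Sym2 V) : Sym2 V → ZMod 2 :=
  ∑ e' : Sym2 V with e' ∈ predecessors G T e₀ e ∪ {e}, vec (fundCycle G T e')

/-- The cycle space of `G` over `ℤ/2`, spanned by the cycles of `G`. -/
noncomputable def cycleSpace : Submodule (ZMod 2) (Sym2 V → ZMod 2) :=
  Submodule.span (ZMod 2)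
    {z | ∃ (u : V) (C : G.Walk u u), C.IsCycle ∧ z = vec {x | x ∈ C.edges}}

/-- A family of vectors over `ℤ/2` is a basis of the cycle space of `G`. -/
def IsCycleBasis {ι : Type*} (b : ι → Sym2 V → ZMod 2) : Prop :=
  LinearIndependent (ZMod 2) b ∧ Submodule.span (ZMod 2) (Set.range b) = cycleSpace G

/-- `f` is a face adjacent to the edge `e` that lies inside the fundamental cycle `C(e)`, where `f₀`
is the outer face. -/
def IsInnerFace {G : SimpleGraph V} (T : SimpleGraph V) (M : Embedding G) (f₀ : M.Face)
    (e : Sym2 V) (f : M.Face) : Prop :=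
  e ∈ M.faceEdges f ∧ M.Inside f₀ (fundCycle G T e) f

end Fundamental

end PlanarBasis

/-! The proof replaces plane topology by linear algebra over `ℤ/2`. A set of faces is a function `g`
on faces, and its `coboundary` is the set of edges that separate it from its complement.
Coboundaries are even subgraphs, and an even subgraph is determined by its non-tree edges
(`eq_zero_of_nonTree_eq_zero`). By Euler's formula there is one face more than there are non-tree
edges, and only constants have zero coboundary, so every even subgraph bounds a set of faces
(`exists_coboundary_eq`). This is the Jordan curve theorem in homological form: `C(e)` bounds
exactly one set of faces `side e` without the outer face, and this set consists of the faces inside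
`C(e)` (`inside_iff`).

The combinatorial order is then identified with geometric enclosure. Conflicting bridges lie on
different sides of a fundamental cycle (`ne_of_conflict`). Since `G` is 3-connected, the conflict
graph is connected (`conflictGraph_preconnected`), so its 2-colouring is unique up to exchanging the
colours and records the sides (`bridge_colour_iff`). Hence `e' ≺ e` says that `e'` lies strictly
inside `C(e)` (`prec_iff`).

It follows that the order is asymmetric and that enclosed cycles have nested insides. The non-tree
edges of the inner face at `e` are `e` and its immediate predecessors
(`mem_faceEdges_innerFace_iff`). The face boundary and `F(e)` are therefore even subgraphs with the
same non-tree edges, hence equal. Passing from the cycles `C(e)` to the faces is a triangular change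
of basis with respect to the number of enclosed faces. -/

namespace PlanarBasis

open Classical

set_option linter.unusedSectionVars false

/-! ### Even subgraphs over `ℤ/2` and their determination by non-tree edges. -/

section Chains

variable {V : Type*} [Fintype V] {G : SimpleGraph V}

theorem zmod_two_cases (a : ZMod 2) : a = 0 ∨ a = 1 := by
  revert a; decide

theorem add_self_zmod_two {α : Type*} (f : α → ZMod 2) : f + f = 0 := by
  ext x; exact CharTwo.add_self_eq_zero _

/-- The boundary over `ℤ/2` of a set of edges. -/
noncomputable def boundary (G : SimpleGraph V) :
    (Sym2 V → ZMod 2) →ₗ[ZMod 2] (V → ZMod 2) where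
  toFun z v := ∑ d : G.Dart with d.fst = v, z d.edge
  map_add' z z' := by
    ext v; simp [Finset.sum_add_distrib]
  map_smul' a z := by
    ext v; simp [Finset.mul_sum]

theorem boundary_apply (z : Sym2 V → ZMod 2) (v : V) :
    boundary G z v = ∑ d : G.Dart with d.fst = v, z d.edge := rfl

/-- The even subgraphs of `G`, as vectors over `ℤ/2`. -/
noncomputable def evenSpace (G : SimpleGraph V) : Submodule (ZMod 2) (Sym2 V → ZMod 2) where
  carrier := {z | boundary G z = 0 ∧ ∀ x ∉ G.edgeSet, z x = 0}
  add_mem' := by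
    rintro a b ⟨ha, ha'⟩ ⟨hb, hb'⟩
    exact ⟨by simp [ha, hb], fun x hx => by simp [ha' x hx, hb' x hx]⟩
  zero_mem' := ⟨by simp, fun _ _ => rfl⟩
  smul_mem' := by
    rintro c a ⟨ha, ha'⟩
    exact ⟨by simp [ha], fun x hx => by simp [ha' x hx]⟩

theorem single_edge_apply (d₀ d : G.Dart) :
    (Pi.single d₀.edge 1 : Sym2 V → ZMod 2) d.edge =
      (if d = d₀ then 1 else 0) + (if d = d₀.symm then 1 else 0) := by
  simp only [Pi.single_apply, SimpleGraph.dart_edge_eq_iff]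
  by_cases h : d = d₀
  · subst h
    simp [d.symm_ne.symm]
  · simp [h]

theorem boundary_single (d₀ : G.Dart) :
    boundary G (Pi.single d₀.edge 1) = Pi.single d₀.fst 1 + Pi.single d₀.snd 1 := by
  ext v
  rw [boundary_apply, Finset.sum_filter]
  simp only [single_edge_apply]
  have : ∀ d : G.Dart, (if d.fst = v then ((if d = d₀ then 1 else 0 : ZMod 2) +
      (if d = d₀.symm then 1 else 0)) else 0) =
      (if d = d₀ then (if d.fst = v then 1 else 0) else 0) +
      (if d = d₀.symm then (if d.fst = v then 1 else 0) else 0) := by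
    intro d; split_ifs <;> simp
  simp only [this, Finset.sum_add_distrib, Finset.sum_ite_eq', Finset.mem_univ, if_true]
  simp [Pi.single_apply, eq_comm]

theorem boundary_single_adj {a b : V} (h : G.Adj a b) :
    boundary G (Pi.single s(a, b) 1) = Pi.single a 1 + Pi.single b 1 :=
  boundary_single (⟨(a, b), h⟩ : G.Dart)

/-- The edges of a walk, counted modulo two. -/
noncomputable def walkVec {u v : V} (w : G.Walk u v) : Sym2 V → ZMod 2 :=
  (w.edges.map fun x => Pi.single x 1).sum

theorem boundary_walkVec {u v : V} (w : G.Walk u v) :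
    boundary G (walkVec w) = Pi.single u 1 + Pi.single v 1 := by
  induction w with
  | nil => simp [walkVec, add_self_zmod_two]
  | @cons u v w h p ih =>
    have : walkVec (SimpleGraph.Walk.cons h p) = Pi.single s(u, v) 1 + walkVec p := by
      simp [walkVec]
    rw [this, map_add, ih, boundary_single_adj h]
    have h2 : (Pi.single v 1 + Pi.single v 1 : V → ZMod 2) = 0 := add_self_zmod_two _
    calc _ = (Pi.single u 1 + Pi.single w 1 : V → ZMod 2) +
        (Pi.single v 1 + Pi.single v 1) := by abel
      _ = _ := by rw [h2, add_zero]

theorem walkVec_eq_vec {u v : V} (w : G.Walk u v) (hw : w.edges.Nodup) :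
    walkVec w = vec {x | x ∈ w.edges} := by
  ext x
  rw [walkVec]
  generalize w.edges = l at hw
  induction l with
  | nil => simp [vec]
  | cons y l ih =>
    rw [List.nodup_cons] at hw
    rw [List.map_cons, List.sum_cons, Pi.add_apply, ih hw.2, Pi.single_apply]
    by_cases h : x = y
    · subst h; simp [vec, hw.1]
    · simp [vec, h, Set.indicator_apply]

theorem walkVec_apply_of_notMem {u v : V} (w : G.Walk u v) {x : Sym2 V} (hx : x ∉ w.edges) :
    walkVec w x = 0 := by
  rw [walkVec]
  generalize w.edges = l at hx
  induction l with
  | nil => simp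
  | cons y l ih => simp_all

theorem vec_apply (S : Set (Sym2 V)) (x : Sym2 V) : vec S x = if x ∈ S then 1 else 0 := by
  simp [vec, Set.indicator_apply]

theorem vec_cycle_mem_evenSpace {u : V} {C : G.Walk u u} (hC : C.IsCycle) :
    vec {x | x ∈ C.edges} ∈ evenSpace G := by
  rw [← walkVec_eq_vec C hC.edges_nodup]
  refine ⟨?_, fun x hx => walkVec_apply_of_notMem C fun h => hx (C.edges_subset_edgeSet h)⟩
  rw [boundary_walkVec]
  exact add_self_zmod_two _

theorem cycleSpace_le_evenSpace : cycleSpace G ≤ evenSpace G := by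
  rw [cycleSpace, Submodule.span_le]
  rintro z ⟨u, C, hC, rfl⟩
  exact vec_cycle_mem_evenSpace hC

/-- An even subgraph is determined by its edges outside a forest. -/
theorem eq_zero_of_nonTree_eq_zero {T : SimpleGraph V} (hT : T.IsAcyclic)
    {z : Sym2 V → ZMod 2} (hz : z ∈ evenSpace G) (h : ∀ e, NonTree G T e → z e = 0) : z = 0 := by
  ext x
  show z x = 0
  by_cases hxG : x ∈ G.edgeSet
  swap
  · exact hz.2 x hxG
  by_cases hxT : x ∈ T.edgeSet
  swap
  · exact h x ⟨hxG, hxT⟩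
  induction x with | _ a b
  have hbr := SimpleGraph.isAcyclic_iff_forall_isBridge.1 hT hxT
  rw [SimpleGraph.isBridge_iff] at hbr
  set T' := T.deleteEdges {s(a, b)} with hT'
  -- Sum the zero boundary over the side of `a` in `T - ab`. Edges within this side count twice, so
  -- only the cut remains, and `ab` is the only edge of the cut on which `z` can be nonzero.
  let S : V → Prop := fun v => T'.Reachable a v
  have hsum : ∑ d : G.Dart with S d.fst, z d.edge = 0 := by
    have : ∑ v with S v, boundary G z v = 0 := by rw [hz.1]; simp
    rw [← this]
    simp only [boundary_apply]
    rw [← Finset.sum_fiberwise_of_maps_to (s := Finset.univ.filter fun d : G.Dart => S d.fst)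
      (t := Finset.univ.filter S) (g := fun d => d.fst) (by simp)]
    refine Finset.sum_congr rfl fun v hv => Finset.sum_congr ?_ fun _ _ => rfl
    ext d
    simp only [Finset.mem_filter, Finset.mem_univ, true_and] at hv ⊢
    exact ⟨fun h => h.2, fun h => ⟨h ▸ hv, h⟩⟩
  have hin : ∑ d : G.Dart with (S d.fst ∧ S d.snd), z d.edge = 0 := by
    refine Finset.sum_involution (fun d _ => d.symm) (fun d _ => ?_) (fun d _ _ => d.symm_ne)
      (fun d hd => ?_) (fun d _ => d.symm_symm)
    · rw [SimpleGraph.Dart.edge_symm]; exact CharTwo.add_self_eq_zero _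
    · simp only [Finset.mem_filter, Finset.mem_univ, true_and] at hd ⊢
      exact ⟨hd.2, hd.1⟩
  have hout : ∑ d : G.Dart with (S d.fst ∧ ¬ S d.snd), z d.edge = z s(a, b) := by
    rw [Finset.sum_eq_single (⟨(a, b), hxG⟩ : G.Dart)]
    · rfl
    · rintro d hd hne
      simp only [Finset.mem_filter, Finset.mem_univ, true_and] at hd
      by_cases hdT : d.edge ∈ T.edgeSet
      swap
      · exact h _ ⟨d.edge_mem, hdT⟩
      exfalso
      by_cases hde : d.edge = s(a, b)
      · rcases (SimpleGraph.dart_edge_eq_iff d ⟨(a, b), hxG⟩).1 hde with h1 | h1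
        · exact hne h1
        · subst h1
          exact hbr hd.1
      · refine hd.2 (hd.1.trans (SimpleGraph.Adj.reachable ?_))
        rw [hT', SimpleGraph.deleteEdges_adj]
        exact ⟨hdT, fun h2 => hde h2⟩
    · intro h1
      exact absurd (Finset.mem_filter.2 ⟨Finset.mem_univ _, SimpleGraph.Reachable.refl a, hbr⟩) h1
  rw [← hout, ← hsum, ← Finset.sum_filter_add_sum_filter_not
    (Finset.univ.filter fun d : G.Dart => S d.fst) (fun d => S d.snd), Finset.filter_filter,
    Finset.filter_filter, hin, zero_add]

end Chains

/-! ### Sets of faces, their boundaries, and Euler's formula. -/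

section Coboundary

variable {V : Type*} [Fintype V] {G T : SimpleGraph V} (M : Embedding G)

instance : Finite M.Face :=
  inferInstanceAs (Finite (Quotient (Equiv.Perm.SameCycle.setoid M.facePerm)))

noncomputable instance : Fintype M.Face := Fintype.ofFinite _

theorem exists_faceOf_eq (f : M.Face) : ∃ d, M.faceOf d = f := Quotient.exists_rep f

theorem faceOf_rot (d : G.Dart) : M.faceOf (M.rot d) = M.faceOf d.symm := by
  refine (Quotient.sound ?_ : M.faceOf d.symm = M.faceOf (M.rot d)).symm
  refine ⟨1, ?_⟩
  simp [Embedding.facePerm]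

/-- The edges between a set of faces and its complement, over `ℤ/2`. -/
noncomputable def coboundary : (M.Face → ZMod 2) →ₗ[ZMod 2] (Sym2 V → ZMod 2) where
  toFun g x := ∑ d : G.Dart with d.edge = x, g (M.faceOf d)
  map_add' g g' := by ext x; simp [Finset.sum_add_distrib]
  map_smul' a g := by ext x; simp [Finset.mul_sum]

theorem coboundary_apply (g : M.Face → ZMod 2) (x : Sym2 V) :
    coboundary M g x = ∑ d : G.Dart with d.edge = x, g (M.faceOf d) := rfl

theorem coboundary_edge (g : M.Face → ZMod 2) (d : G.Dart) :
    coboundary M g d.edge = g (M.faceOf d) + g (M.faceOf d.symm) := by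
  have : (Finset.univ.filter fun d' : G.Dart => d'.edge = d.edge) = {d, d.symm} := by
    ext d'
    simpa using SimpleGraph.dart_edge_eq_iff d' d
  rw [coboundary_apply, this, Finset.sum_pair d.symm_ne.symm]

theorem eq_iff_coboundary_edge_eq_zero (g : M.Face → ZMod 2) (d : G.Dart) :
    g (M.faceOf d) = g (M.faceOf d.symm) ↔ coboundary M g d.edge = 0 := by
  rw [coboundary_edge]
  exact CharTwo.add_eq_zero.symm

/-- The second face at a dart is the first face at the next dart of the rotation, so around a vertex
every value of `g` occurs twice and cancels. -/
theorem coboundary_mem_evenSpace (g : M.Face → ZMod 2) : coboundary M g ∈ evenSpace G := by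
  refine ⟨?_, fun x hx => ?_⟩
  · ext v
    rw [boundary_apply]
    simp only [coboundary_edge, Finset.sum_add_distrib, ← faceOf_rot]
    have : ∑ d : G.Dart with d.fst = v, g (M.faceOf (M.rot d)) =
        ∑ d : G.Dart with d.fst = v, g (M.faceOf d) :=
      Finset.sum_equiv M.rot (fun d => by simp [M.rot_fst]) (fun _ _ => rfl)
    rw [this]
    exact CharTwo.add_self_eq_zero _
  · rw [coboundary_apply]
    refine Finset.sum_eq_zero fun d hd => ?_
    rw [Finset.mem_filter] at hd
    exact absurd (hd.2 ▸ d.edge_mem) hx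

/-- A set of faces contains all or none of the faces at a vertex, if no edge at this vertex
belongs to its boundary. -/
theorem eq_of_fst_eq {g : M.Face → ZMod 2} {v : V}
    (h : ∀ d : G.Dart, d.fst = v → coboundary M g d.edge = 0) {d d' : G.Dart}
    (hd : d.fst = v) (hd' : d'.fst = v) : g (M.faceOf d) = g (M.faceOf d') := by
  have hrot : ∀ d : G.Dart, d.fst = v → g (M.faceOf (M.rot d)) = g (M.faceOf d) := by
    intro d hd
    rw [faceOf_rot, ← (eq_iff_coboundary_edge_eq_zero M g d).2 (h d hd)]
  have hnat : ∀ n : ℕ, ∀ d : G.Dart, d.fst = v →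
      ((M.rot ^ n) d).fst = v ∧ g (M.faceOf ((M.rot ^ n) d)) = g (M.faceOf d) := by
    intro n
    induction n with
    | zero => intro d hd; exact ⟨hd, rfl⟩
    | succ n ih =>
      intro d hd
      rw [pow_succ', Equiv.Perm.mul_apply]
      obtain ⟨h1, h2⟩ := ih d hd
      exact ⟨(M.rot_fst _).trans h1, (hrot _ h1).trans h2⟩
  obtain ⟨n, -, hn⟩ := (M.rot_cyclic d d' (hd.trans hd'.symm)).exists_pow_eq'
  rw [← hn]
  exact ((hnat n d hd).2).symm

/-- With zero boundary, `g` does not change around a vertex or across an edge, and a walk in `G`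
links any two darts. -/
theorem eq_of_coboundary_eq_zero (hG : G.Connected) {g : M.Face → ZMod 2}
    (h : coboundary M g = 0) (f f' : M.Face) : g f = g f' := by
  obtain ⟨d, rfl⟩ := exists_faceOf_eq M f
  obtain ⟨d', rfl⟩ := exists_faceOf_eq M f'
  have h0 : ∀ d : G.Dart, coboundary M g d.edge = 0 := fun d => by rw [h]; rfl
  obtain ⟨w⟩ := hG.preconnected d.fst d'.fst
  generalize hu : d.fst = u at w
  generalize hv : d'.fst = v at w
  induction w generalizing d with
  | nil => exact eq_of_fst_eq M (fun d _ => h0 d) hu hv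
  | @cons a b c hab p ih =>
    let e : G.Dart := ⟨(a, b), hab⟩
    rw [eq_of_fst_eq M (fun d _ => h0 d) hu (rfl : e.fst = a),
      (eq_iff_coboundary_edge_eq_zero M g e).2 (h0 e)]
    exact ih e.symm rfl hv

theorem coboundary_const (a : ZMod 2) : coboundary M (fun _ => a) = 0 := by
  ext x
  by_cases hx : x ∈ G.edgeSet
  · induction x with | _ u v
    have := coboundary_edge M (fun _ => a) ⟨(u, v), hx⟩
    exact this.trans (CharTwo.add_self_eq_zero a)
  · exact (coboundary_mem_evenSpace M _).2 x hx

theorem card_nonTree (hTG : T ≤ G) (hT : T.IsTree) (hM : M.Planar) :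
    Nat.card M.Face = Nat.card {e : Sym2 V // NonTree G T e} + 1 := by
  have h1 : T.edgeSet.ncard + 1 = Nat.card V := by
    rw [Nat.card_eq_fintype_card, ← hT.card_edgeFinset, ← SimpleGraph.coe_edgeFinset,
      Set.ncard_coe_finset]
  have h2 : (G.edgeSet \ T.edgeSet).ncard + T.edgeSet.ncard = G.edgeSet.ncard :=
    Set.ncard_sdiff_add_ncard_of_subset (SimpleGraph.edgeSet_mono hTG)
  have h3 : Nat.card {e : Sym2 V // NonTree G T e} = (G.edgeSet \ T.edgeSet).ncard := rfl
  have h4 : Nat.card G.edgeSet = G.edgeSet.ncard := rfl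
  have := hM
  unfold Embedding.Planar at this
  omega

/-- In a planar embedding every set of values on the non-tree edges is attained by the boundary of
some set of faces. -/
theorem exists_coboundary_eq_on_nonTree (hTG : T ≤ G) (hT : T.IsTree) (hM : M.Planar)
    (z : Sym2 V → ZMod 2) : ∃ g, ∀ e, NonTree G T e → coboundary M g e = z e := by
  let Φ : (M.Face → ZMod 2) →ₗ[ZMod 2] ({e : Sym2 V // NonTree G T e} → ZMod 2) :=
    (LinearMap.funLeft (ZMod 2) (ZMod 2) Subtype.val).comp (coboundary M)
  have hG : G.Connected := hT.connected.mono hTG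
  -- A coboundary that vanishes on all non-tree edges vanishes altogether, so the kernel contains
  -- only constants.
  have hker : LinearMap.ker Φ ≤ Submodule.span (ZMod 2) {fun _ => 1} := by
    intro g hg
    have h0 : coboundary M g = 0 := eq_zero_of_nonTree_eq_zero hT.isAcyclic
      (coboundary_mem_evenSpace M g) fun e he => congrFun (LinearMap.mem_ker.1 hg) ⟨e, he⟩
    have hc := eq_of_coboundary_eq_zero M hG h0
    rw [Submodule.mem_span_singleton]
    by_cases hF : Nonempty M.Face
    · obtain ⟨f⟩ := hF
      exact ⟨g f, by ext f'; simp [hc f' f]⟩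
    · exact ⟨0, by ext f'; exact absurd ⟨f'⟩ hF⟩
  have h1 : Module.finrank (ZMod 2) (LinearMap.ker Φ) ≤ 1 :=
    (Submodule.finrank_mono hker).trans ((finrank_span_le_card _).trans (by simp))
  have h2 := LinearMap.finrank_range_add_finrank_ker Φ
  have h3 := card_nonTree M hTG hT hM
  -- The rank is at least the number of faces minus one, which Euler's formula identifies with the
  -- dimension of the target.
  have h4 : LinearMap.range Φ = ⊤ := by
    refine Submodule.eq_top_of_finrank_eq (le_antisymm (Submodule.finrank_le _) ?_)
    rw [Module.finrank_fintype_fun_eq_card] at h2 ⊢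
    rw [← Nat.card_eq_fintype_card] at h2 ⊢
    omega
  obtain ⟨g, hg⟩ := LinearMap.range_eq_top.1 h4 fun e => z e
  exact ⟨g, fun e he => congrFun hg ⟨e, he⟩⟩

theorem eq_of_eq_on_nonTree (hT : T.IsAcyclic) {z z' : Sym2 V → ZMod 2} (hz : z ∈ evenSpace G)
    (hz' : z' ∈ evenSpace G) (h : ∀ e, NonTree G T e → z e = z' e) : z = z' :=
  sub_eq_zero.1 (eq_zero_of_nonTree_eq_zero hT ((evenSpace G).sub_mem hz hz')
    fun e he => by simp [h e he])

theorem exists_coboundary_eq (hTG : T ≤ G) (hT : T.IsTree) (hM : M.Planar)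
    {z : Sym2 V → ZMod 2} (hz : z ∈ evenSpace G) : ∃ g, coboundary M g = z := by
  obtain ⟨g, hg⟩ := exists_coboundary_eq_on_nonTree M hTG hT hM z
  exact ⟨g, eq_of_eq_on_nonTree hT.isAcyclic (coboundary_mem_evenSpace M g) hz hg⟩

end Coboundary

/-! ### Fundamental cycles as even subgraphs. -/

section FundamentalCycle

variable {V : Type*} [Fintype V] {G T : SimpleGraph V}

theorem vec_injective : Function.Injective (vec : Set (Sym2 V) → _) := by
  intro S S' h
  ext x
  have := congrFun h x
  simp only [vec_apply] at this
  by_cases h1 : x ∈ S <;> by_cases h2 : x ∈ S' <;> simp_all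

theorem exists_isFundCycle (hTG : T ≤ G) (hT : T.IsTree) {e : Sym2 V} (he : NonTree G T e) :
    ∃ (u : V) (C : G.Walk u u), IsFundCycle T e C := by
  induction e with | _ a b
  obtain ⟨p, hp⟩ := (hT.connected.preconnected b a).exists_isPath
  have hedges : ∀ x ∈ (p.mapLe hTG).edges, x ∈ T.edgeSet := by
    intro x hx
    rw [SimpleGraph.Walk.edges_mapLe_eq_edges] at hx
    exact p.edges_subset_edgeSet hx
  refine ⟨a, SimpleGraph.Walk.cons (show G.Adj a b from he.1) (p.mapLe hTG), ?_, ?_⟩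
  · rw [SimpleGraph.Walk.cons_isCycle_iff]
    exact ⟨(SimpleGraph.Walk.isPath_mapLe hTG).2 hp, fun h => he.2 (hedges _ h)⟩
  · intro x hx
    rw [SimpleGraph.Walk.edges_cons, List.mem_cons] at hx
    exact hx.elim Or.inr fun h => Or.inl (hedges x h)

theorem mem_edges_of_isFundCycle (hT : T.IsAcyclic) {e : Sym2 V} {u : V} {C : G.Walk u u}
    (hC : IsFundCycle T e C) : e ∈ C.edges := by
  by_contra h
  have h0 : vec {x | x ∈ C.edges} = 0 := by
    refine eq_zero_of_nonTree_eq_zero hT (vec_cycle_mem_evenSpace hC.1) fun x hx => ?_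
    rw [vec_apply, if_neg]
    exact fun hx' => (hC.2 x hx').elim hx.2 fun hxe => h (hxe ▸ hx')
  have hne : C.edges ≠ [] := by
    intro h1
    have := hC.1.three_le_length
    rw [← SimpleGraph.Walk.length_edges, h1] at this
    simp at this
  obtain ⟨x, hx⟩ := List.exists_mem_of_ne_nil _ hne
  have := congrFun h0 x
  rw [vec_apply, if_pos (show x ∈ {x | x ∈ C.edges} from hx)] at this
  exact one_ne_zero this

theorem vec_isFundCycle_apply (hT : T.IsAcyclic) {e : Sym2 V} {u : V} {C : G.Walk u u}
    (hC : IsFundCycle T e C) {x : Sym2 V} (hx : NonTree G T x) :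
    vec {x | x ∈ C.edges} x = if x = e then 1 else 0 := by
  rw [vec_apply]
  congr 1
  refine propext ⟨fun h => (hC.2 x h).elim (fun h => absurd h hx.2) id, fun h => ?_⟩
  exact h ▸ mem_edges_of_isFundCycle hT hC

/-- `fundCycle` is a union over all closed walks that qualify. Any two of them have `e` as their
only non-tree edge, so their edge sets coincide. -/
theorem fundCycle_eq (hT : T.IsAcyclic) {e : Sym2 V} {u : V} {C : G.Walk u u}
    (hC : IsFundCycle T e C) : fundCycle G T e = {x | x ∈ C.edges} := by
  ext x
  refine ⟨?_, fun h => ⟨u, C, hC, h⟩⟩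
  rintro ⟨v, C', hC', hx⟩
  have : vec {x | x ∈ C'.edges} = vec {x | x ∈ C.edges} :=
    eq_of_eq_on_nonTree hT (vec_cycle_mem_evenSpace hC'.1) (vec_cycle_mem_evenSpace hC.1)
      fun y hy => by rw [vec_isFundCycle_apply hT hC' hy, vec_isFundCycle_apply hT hC hy]
  rw [← vec_injective this]
  exact hx

theorem vec_fundCycle_mem_evenSpace (hTG : T ≤ G) (hT : T.IsTree) {e : Sym2 V}
    (he : NonTree G T e) : vec (fundCycle G T e) ∈ evenSpace G := by
  obtain ⟨u, C, hC⟩ := exists_isFundCycle hTG hT he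
  rw [fundCycle_eq hT.isAcyclic hC]
  exact vec_cycle_mem_evenSpace hC.1

theorem vec_fundCycle_apply (hTG : T ≤ G) (hT : T.IsTree) {e : Sym2 V}
    (he : NonTree G T e) {x : Sym2 V} (hx : NonTree G T x) :
    vec (fundCycle G T e) x = if x = e then 1 else 0 := by
  obtain ⟨u, C, hC⟩ := exists_isFundCycle hTG hT he
  rw [fundCycle_eq hT.isAcyclic hC]
  exact vec_isFundCycle_apply hT.isAcyclic hC hx

end FundamentalCycle

/-! ### Bridges partition the edges off the cycle. -/

section BridgeEdges

variable {V : Type*} {G : SimpleGraph V} {u : V} {C : G.Walk u u}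

theorem Bridge.mem_edgeSet {B : Bridge C} {x : Sym2 V} (hx : x ∈ B.edges) : x ∈ G.edgeSet := by
  rcases B with X | y
  · exact hx.1
  · rw [show x = y.1 from hx]; exact y.2.1

theorem Bridge.notMem_cycle {B : Bridge C} {x : Sym2 V} (hx : x ∈ B.edges) : x ∉ C.edges := by
  rcases B with X | y
  · obtain ⟨-, v, -, hv⟩ := hx
    exact fun h => v.2 (C.mem_support_of_mem_edges h hv)
  · rw [show x = y.1 from hx]; exact y.2.2.1

theorem Bridge.eq_of_mem_edges {B B' : Bridge C} {x : Sym2 V} (hx : x ∈ B.edges)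
    (hx' : x ∈ B'.edges) : B = B' := by
  rcases B with X | y <;> rcases B' with X' | y'
  · obtain ⟨hxG, v, rfl, hv⟩ := hx
    obtain ⟨-, v', rfl, hv'⟩ := hx'
    congr 1
    rw [SimpleGraph.ConnectedComponent.eq]
    by_cases hvv : v = v'
    · rw [hvv]
    · refine SimpleGraph.Adj.reachable ?_
      have : x = s((v : V), (v' : V)) :=
        (Sym2.mem_and_mem_iff (fun h => hvv (Subtype.ext h))).1 ⟨hv, hv'⟩
      rw [this] at hxG
      exact hxG
  · obtain ⟨-, v, -, hv⟩ := hx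
    rw [show x = y'.1 from hx'] at hv
    exact absurd (y'.2.2.2 _ hv) v.2
  · obtain ⟨-, v, -, hv⟩ := hx'
    rw [show x = y.1 from hx] at hv
    exact absurd (y.2.2.2 _ hv) v.2
  · congr 1
    exact Subtype.ext ((show x = y.1 from hx).symm.trans hx')

theorem exists_bridge {x : Sym2 V} (hx : x ∈ G.edgeSet) (hxC : x ∉ C.edges) :
    ∃ B : Bridge C, x ∈ B.edges := by
  by_cases h : ∀ v ∈ x, v ∈ C.support
  · exact ⟨Sum.inr ⟨x, hx, hxC, h⟩, rfl⟩
  · push Not at h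
    obtain ⟨v, hv, hvC⟩ := h
    exact ⟨Sum.inl ((G.induce _).connectedComponentMk ⟨v, hvC⟩), hx, ⟨v, hvC⟩, rfl, hv⟩

theorem Bridge.attachments_subset {B : Bridge C} {a : V} (ha : a ∈ B.attachments) :
    a ∈ C.support := by
  rcases B with X | y
  · exact ha.1
  · exact y.2.2.2 a ha

theorem Bridge.exists_dart_of_mem_attachments {B : Bridge C} {a : V} (ha : a ∈ B.attachments) :
    ∃ d : G.Dart, d.fst = a ∧ d.edge ∈ B.edges := by
  rcases B with X | ⟨y, hy⟩
  · obtain ⟨-, v, hvX, hva⟩ := ha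
    exact ⟨⟨(a, v), hva.symm⟩, rfl, hva.symm, v, hvX, Sym2.mem_mk_right _ _⟩
  · obtain ⟨b, rfl⟩ := Sym2.mem_iff_exists.1 (show a ∈ y from ha)
    exact ⟨⟨(a, b), hy.1⟩, rfl, rfl⟩

end BridgeEdges

/-! ### A bridge lies on one side of a boundary that avoids it. -/

section BridgeFaces

variable {V : Type*} [Fintype V] {G : SimpleGraph V} (M : Embedding G) {u : V} {C : G.Walk u u}

/-- A set of faces whose boundary avoids a bridge contains all or none of the faces at the
bridge. -/
theorem eq_of_mem_bridge_edges {h : M.Face → ZMod 2} {B : Bridge C}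
    (hB : ∀ x ∈ B.edges, coboundary M h x = 0) {d d' : G.Dart} (hd : d.edge ∈ B.edges)
    (hd' : d'.edge ∈ B.edges) : h (M.faceOf d) = h (M.faceOf d') := by
  rcases B with X | y
  · have key : ∀ v v' : {v : V | v ∉ C.support}, (G.induce _).connectedComponentMk v = X →
        (G.induce {v : V | v ∉ C.support}).Reachable v v' → ∀ d d' : G.Dart, d.fst = v →
        d'.fst = v' → h (M.faceOf d) = h (M.faceOf d') := by
      rintro v v' hv ⟨w⟩
      have hat : ∀ v : {v : V | v ∉ C.support}, (G.induce _).connectedComponentMk v = X →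
          ∀ d : G.Dart, d.fst = v → coboundary M h d.edge = 0 := fun v hv d hd =>
        hB _ ⟨d.edge_mem, v, hv, by rw [← hd]; exact Sym2.mem_mk_left _ _⟩
      induction w with
      | nil => exact fun d d' hd hd' => eq_of_fst_eq M (hat _ hv) hd hd'
      | @cons a b c hab p ih =>
        intro d d' hd hd'
        let e : G.Dart := ⟨(a, b), hab⟩
        rw [eq_of_fst_eq M (hat _ hv) hd (rfl : e.fst = a),
          (eq_iff_coboundary_edge_eq_zero M h e).2 (hat _ hv e rfl)]
        refine ih ?_ e.symm d' rfl hd'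
        rw [← hv, SimpleGraph.ConnectedComponent.eq]
        exact (SimpleGraph.Adj.reachable hab).symm
    have hend : ∀ d : G.Dart, d.edge ∈ Bridge.edges (Sum.inl X : Bridge C) →
        ∃ v : {v : V | v ∉ C.support}, (G.induce _).connectedComponentMk v = X ∧
        ∃ d' : G.Dart, d'.fst = v ∧ h (M.faceOf d) = h (M.faceOf d') := by
      rintro d ⟨h1, v, hv, hvd⟩
      refine ⟨v, hv, ?_⟩
      rcases Sym2.mem_iff.1 (show (v : V) ∈ s(d.fst, d.snd) from hvd) with h2 | h2
      · exact ⟨d, h2.symm, rfl⟩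
      · exact ⟨d.symm, h2.symm, (eq_iff_coboundary_edge_eq_zero M h d).2 (hB _ ⟨h1, v, hv, hvd⟩)⟩
    obtain ⟨v, hv, e, he, h1⟩ := hend d hd
    obtain ⟨v', hv', e', he', h2⟩ := hend d' hd'
    rw [h1, h2]
    refine key v v' hv ?_ e e' he he'
    rw [← SimpleGraph.ConnectedComponent.eq, hv, hv']
  · rcases (SimpleGraph.dart_edge_eq_iff d d').1
      ((show d.edge = y.1 from hd).trans (show d'.edge = y.1 from hd').symm) with h1 | h1
    · rw [h1]
    · rw [h1]
      exact ((eq_iff_coboundary_edge_eq_zero M h d').2 (hB _ hd')).symm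

end BridgeFaces

/-! ### Chains through a bridge between points of attachment. -/

section BridgeChains

variable {V : Type*} [Fintype V] {G : SimpleGraph V} {u : V} {C : G.Walk u u}

/-- The hub `x₀` does not depend on `a`: two such chains add up to a connection through the bridge,
and three form a tripod. A walk may repeat edges, as only its boundary and support modulo two
matter. -/
theorem exists_chain_to_component (X : (G.induce {v : V | v ∉ C.support}).ConnectedComponent) :
    ∃ x₀ : V, ∀ a ∈ Bridge.attachments (Sum.inl X : Bridge C), ∃ q : Sym2 V → ZMod 2,
      (∀ x, q x ≠ 0 → x ∈ Bridge.edges (Sum.inl X : Bridge C)) ∧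
      (∀ x, q x ≠ 0 → ∀ v ∈ C.support, v ∈ x → v = a) ∧
      boundary G q = Pi.single a 1 + Pi.single x₀ 1 := by
  induction X using SimpleGraph.ConnectedComponent.ind with | _ x₀
  refine ⟨x₀, ?_⟩
  rintro a ⟨haC, v, hvX, hva⟩
  obtain ⟨w⟩ := SimpleGraph.ConnectedComponent.eq.1 hvX
  let w' : G.Walk v x₀ := w.map (SimpleGraph.Embedding.induce {v : V | v ∉ C.support}).toHom
  have hw' : ∀ x ∈ w'.edges, x ∈ G.edgeSet ∧ ∀ y ∈ x, ∃ hy : y ∉ C.support,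
      (G.induce {v : V | v ∉ C.support}).connectedComponentMk ⟨y, hy⟩ =
        (G.induce {v : V | v ∉ C.support}).connectedComponentMk x₀ := by
    intro x hx
    refine ⟨w'.edges_subset_edgeSet hx, fun y hy => ?_⟩
    have := w'.mem_support_of_mem_edges hx hy
    rw [show w'.support = _ from SimpleGraph.Walk.support_map _ _, List.mem_map] at this
    obtain ⟨y', hy', rfl⟩ := this
    exact ⟨y'.2, SimpleGraph.ConnectedComponent.eq.2 ⟨w.dropUntil y' hy'⟩⟩
  let p : G.Walk a x₀ := SimpleGraph.Walk.cons hva.symm w'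
  have hp : ∀ x, walkVec p x ≠ 0 → x = s(a, (v : V)) ∨ x ∈ w'.edges := by
    intro x hx
    by_contra hcon
    refine hx (walkVec_apply_of_notMem p fun h => hcon ?_)
    rwa [SimpleGraph.Walk.edges_cons, List.mem_cons] at h
  refine ⟨walkVec p, fun x hx => ?_, fun x hx b hb hbx => ?_, boundary_walkVec p⟩
  · rcases hp x hx with rfl | h
    · exact ⟨hva.symm, v, hvX, Sym2.mem_mk_right _ _⟩
    · obtain ⟨h1, h2⟩ := hw' x h
      induction x with | _ y y'
      obtain ⟨hy, hyX⟩ := h2 y (Sym2.mem_mk_left _ _)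
      exact ⟨h1, ⟨y, hy⟩, hyX, Sym2.mem_mk_left _ _⟩
  · rcases hp x hx with rfl | h
    · rcases Sym2.mem_iff.1 hbx with h1 | h1
      · exact h1
      · exact absurd (h1 ▸ hb) v.2
    · exact absurd hb ((hw' x h).2 b hbx).1

theorem exists_chain_through_bridge (B : Bridge C) {a a' : V} (ha : a ∈ B.attachments)
    (ha' : a' ∈ B.attachments) (hne : a ≠ a') : ∃ q : Sym2 V → ZMod 2,
      (∀ x, q x ≠ 0 → x ∈ B.edges) ∧
      (∀ x, q x ≠ 0 → ∀ v ∈ C.support, v ∈ x → v = a ∨ v = a') ∧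
      boundary G q = Pi.single a 1 + Pi.single a' 1 := by
  rcases B with X | ⟨y, hy⟩
  · obtain ⟨x₀, h⟩ := exists_chain_to_component X
    obtain ⟨q, h1, h2, h3⟩ := h a ha
    obtain ⟨q', h1', h2', h3'⟩ := h a' ha'
    have hor : ∀ x, (q + q') x ≠ 0 → q x ≠ 0 ∨ q' x ≠ 0 := by
      intro x hx
      by_contra! hcon
      exact hx (by simp [hcon.1, hcon.2])
    refine ⟨q + q', fun x hx => (hor x hx).elim (h1 x) (h1' x), fun x hx v hv hvx => ?_, ?_⟩
    · exact (hor x hx).elim (fun h => Or.inl (h2 x h v hv hvx)) fun h => Or.inr (h2' x h v hv hvx)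
    · rw [map_add, h3, h3']
      calc _ = (Pi.single a 1 + Pi.single a' 1 : V → ZMod 2) +
            (Pi.single x₀ 1 + Pi.single x₀ 1) := by abel
        _ = _ := by rw [add_self_zmod_two, add_zero]
  · have : y = s(a, a') := (Sym2.mem_and_mem_iff hne).1 ⟨ha, ha'⟩
    subst this
    have hsupp : ∀ x, (Pi.single s(a, a') 1 : Sym2 V → ZMod 2) x ≠ 0 → x = s(a, a') := by
      intro x hx
      by_contra hcon
      exact hx (by rw [Pi.single_apply, if_neg hcon])
    refine ⟨Pi.single s(a, a') 1, fun x hx => hsupp x hx, fun x hx v _ hvx => ?_,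
      boundary_single_adj hy.1⟩
    rw [hsupp x hx] at hvx
    exact Sym2.mem_iff.1 hvx

end BridgeChains

/-! ### Positions and arcs along a cycle. -/

section Arcs

variable {V : Type*} [Fintype V] {G : SimpleGraph V} {u : V}

/-- The edges of a walk at the positions in `I`. -/
noncomputable def arc {u v : V} (C : G.Walk u v) (I : Finset ℕ) : Sym2 V → ZMod 2 :=
  ∑ k ∈ I, Pi.single s(C.getVert k, C.getVert (k + 1)) 1

theorem exists_of_arc_ne_zero {v : V} {C : G.Walk u v} {I : Finset ℕ} {x : Sym2 V}
    (hx : arc C I x ≠ 0) : ∃ k ∈ I, x = s(C.getVert k, C.getVert (k + 1)) := by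
  by_contra! hcon
  refine hx ?_
  rw [arc, Finset.sum_apply]
  exact Finset.sum_eq_zero fun k hk => by rw [Pi.single_apply, if_neg (hcon k hk)]

theorem boundary_arc_Ico {v : V} (C : G.Walk u v) {i j : ℕ} (hij : i ≤ j) (hj : j ≤ C.length) :
    boundary G (arc C (Finset.Ico i j)) =
      Pi.single (C.getVert i) 1 + Pi.single (C.getVert j) 1 := by
  induction j, hij using Nat.le_induction with
  | base => simp [arc, add_self_zmod_two]
  | succ j hij ih =>
    rw [arc, Finset.sum_Ico_succ_top hij, ← arc, map_add, ih (by omega),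
      boundary_single_adj (C.adj_getVert_succ (by omega))]
    calc _ = (Pi.single (C.getVert i) 1 + Pi.single (C.getVert (j + 1)) 1 : V → ZMod 2) +
          (Pi.single (C.getVert j) 1 + Pi.single (C.getVert j) 1) := by abel
      _ = _ := by rw [add_self_zmod_two, add_zero]

theorem arc_range_length {v : V} (C : G.Walk u v) :
    arc C (Finset.range C.length) = walkVec C := by
  induction C with
  | nil => simp [arc, walkVec]
  | cons h p ih =>
    rw [arc, SimpleGraph.Walk.length_cons, Finset.sum_range_succ']
    simp only [SimpleGraph.Walk.getVert_cons_succ, SimpleGraph.Walk.getVert_zero]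
    rw [← arc, ih, walkVec, walkVec, SimpleGraph.Walk.edges_cons, List.map_cons, List.sum_cons,
      add_comm]

theorem arc_union {v : V} (C : G.Walk u v) {I J : Finset ℕ} (h : Disjoint I J) :
    arc C (I ∪ J) = arc C I + arc C J := Finset.sum_union h

theorem getVert_eq_iff {C : G.Walk u u} (hC : C.IsCycle) {i j : ℕ} (hi : i < C.length)
    (hj : j < C.length) : C.getVert i = C.getVert j ↔ i = j :=
  ⟨fun h => hC.getVert_injOn' (by rw [Set.mem_ofPred_eq]; omega)
    (by rw [Set.mem_ofPred_eq]; omega) h, fun h => h ▸ rfl⟩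

/-- The second alternative is the closing edge: position `C.length` is the base vertex again, whose
position is taken to be `0`. -/
theorem getVert_succ_eq_iff {C : G.Walk u u} (hC : C.IsCycle) {i j : ℕ} (hi : i < C.length)
    (hj : j < C.length) :
    C.getVert (i + 1) = C.getVert j ↔ i + 1 = j ∨ (i + 1 = C.length ∧ j = 0) := by
  have h3 := hC.three_le_length
  by_cases h : i + 1 = C.length
  · have h0 : C.getVert C.length = C.getVert 0 := by rw [C.getVert_length, C.getVert_zero]
    rw [h, h0, getVert_eq_iff hC (by omega) hj]
    omega
  · rw [getVert_eq_iff hC (by omega) hj]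
    omega

theorem exists_getVert_eq {C : G.Walk u u} (hC : C.IsCycle) {a : V} (ha : a ∈ C.support) :
    ∃ i < C.length, C.getVert i = a := by
  obtain ⟨i, hi, hle⟩ := SimpleGraph.Walk.mem_support_iff_exists_getVert.1 ha
  have h3 := hC.three_le_length
  rcases hle.lt_or_eq with h | h
  · exact ⟨i, h, hi⟩
  · refine ⟨0, by omega, ?_⟩
    rw [C.getVert_zero, ← hi, h, C.getVert_length]

theorem getVert_edge_mem {v : V} (C : G.Walk u v) {k : ℕ} (hk : k < C.length) :
    s(C.getVert k, C.getVert (k + 1)) ∈ C.edges :=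
  C.mk_mem_edges_iff_exists.2 ⟨k, hk, rfl⟩

theorem arc_apply_eq_zero {C : G.Walk u u} (hC : C.IsCycle) {I : Finset ℕ}
    (hI : ∀ k ∈ I, k < C.length) {l : ℕ} (hl : l < C.length)
    (hIl : ∀ k ∈ I, k ≠ l ∧ k + 1 ≠ l ∧ (l = 0 → k + 1 ≠ C.length)) {x : Sym2 V}
    (hx : C.getVert l ∈ x) : arc C I x = 0 := by
  by_contra hne
  obtain ⟨k, hk, rfl⟩ := exists_of_arc_ne_zero hne
  have := hIl k hk
  rcases Sym2.mem_iff.1 hx with h | h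
  · rw [eq_comm, getVert_eq_iff hC (hI k hk) hl] at h
    omega
  · rw [eq_comm, getVert_succ_eq_iff hC (hI k hk) hl] at h
    omega

theorem arc_sdiff {C : G.Walk u u} (hC : C.IsCycle) {I : Finset ℕ}
    (hI : ∀ k ∈ I, k < C.length) :
    arc C (Finset.range C.length \ I) = vec {x | x ∈ C.edges} + arc C I := by
  rw [← walkVec_eq_vec C hC.edges_nodup, ← arc_range_length]
  have hsub : I ⊆ Finset.range C.length := fun k hk => Finset.mem_range.2 (hI k hk)
  conv_rhs => rw [← Finset.sdiff_union_of_subset hsub, arc_union C Finset.sdiff_disjoint]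
  rw [add_assoc, add_self_zmod_two, add_zero]

theorem mem_edges_of_arc_ne_zero {C : G.Walk u u} {I : Finset ℕ} (hI : ∀ k ∈ I, k < C.length)
    {x : Sym2 V} (hx : arc C I x ≠ 0) : x ∈ C.edges := by
  obtain ⟨k, hk, rfl⟩ := exists_of_arc_ne_zero hx
  exact getVert_edge_mem C (hI k hk)

theorem exists_three_positions {C : G.Walk u u} (hC : C.IsCycle) {A : Set V}
    (hA : ∀ a ∈ A, a ∈ C.support) {a b c : V} (ha : a ∈ A) (hb : b ∈ A) (hc : c ∈ A) (hab : a ≠ b)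
    (hac : a ≠ c) (hbc : b ≠ c) : ∃ i j k : ℕ, i < j ∧ j < k ∧ k < C.length ∧
      C.getVert i ∈ A ∧ C.getVert j ∈ A ∧ C.getVert k ∈ A := by
  obtain ⟨i, hi, rfl⟩ := exists_getVert_eq hC (hA a ha)
  obtain ⟨j, hj, rfl⟩ := exists_getVert_eq hC (hA b hb)
  obtain ⟨k, hk, rfl⟩ := exists_getVert_eq hC (hA c hc)
  have hij : i ≠ j := fun h => hab (h ▸ rfl)
  have hik : i ≠ k := fun h => hac (h ▸ rfl)
  have hjk : j ≠ k := fun h => hbc (h ▸ rfl)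
  rcases lt_or_gt_of_ne hij with h | h <;> rcases lt_or_gt_of_ne hik with h' | h' <;>
    rcases lt_or_gt_of_ne hjk with h'' | h''
  · exact ⟨i, j, k, h, h'', hk, ha, hb, hc⟩
  · exact ⟨i, k, j, h', h'', hj, ha, hc, hb⟩
  · omega
  · exact ⟨k, i, j, h', h, hj, hc, ha, hb⟩
  · exact ⟨j, i, k, h, h', hk, hb, ha, hc⟩
  · omega
  · exact ⟨j, k, i, h'', h', hi, hb, hc, ha⟩
  · exact ⟨k, j, i, h'', h, hi, hc, hb, ha⟩

end Arcs

/-! ### Conflicting bridges lie on different sides; here "inner" means `g = 1`, for any `g` bounded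
by the cycle. -/

section Jordan

variable {V : Type*} [Fintype V] {G T : SimpleGraph V} {M : Embedding G} {u : V} {C : G.Walk u u}
  {e : Sym2 V} {g : M.Face → ZMod 2}

/-- A set of faces with boundary `C` is determined by the faces outside of it being outside. -/
theorem eq_of_coboundary_eq_of_le (hG : G.Connected) (hC : C.IsCycle)
    (hg : coboundary M g = vec {x | x ∈ C.edges}) {k : M.Face → ZMod 2}
    (hk : coboundary M k = vec {x | x ∈ C.edges}) (hkg : ∀ f, g f = 0 → k f = 0) : k = g := by
  have h3 := hC.three_le_length
  have hx := getVert_edge_mem C (show 0 < C.length by omega)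
  let d : G.Dart := ⟨(C.getVert 0, C.getVert 1), C.edges_subset_edgeSet hx⟩
  have h1 : g (M.faceOf d) + g (M.faceOf d.symm) = 1 := by
    rw [← coboundary_edge, hg, vec_apply, if_pos]
    exact hx
  obtain ⟨f, hf⟩ : ∃ f, g f = 0 := by
    rcases zmod_two_cases (g (M.faceOf d)) with h | h
    · exact ⟨_, h⟩
    · refine ⟨M.faceOf d.symm, ?_⟩
      rw [h] at h1
      simpa using h1
  have h0 : coboundary M (k - g) = 0 := by rw [map_sub, hk, hg, sub_self]
  ext f'
  have := eq_of_coboundary_eq_zero M hG h0 f' f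
  simp only [Pi.sub_apply, hf, hkg f hf, sub_zero] at this
  exact sub_eq_zero.1 this

/-- An even subgraph in the closed inside of a fundamental cycle bounds a set of inner faces. -/
theorem exists_inner_coboundary (hTG : T ≤ G) (hT : T.IsTree) (hM : M.Planar)
    (hC : IsFundCycle T e C) (hg : coboundary M g = vec {x | x ∈ C.edges})
    (hin : ∃ f, g f = 1) {Q : Sym2 V → ZMod 2} (hQ : Q ∈ evenSpace G)
    (hQC : ∀ d : G.Dart, Q d.edge ≠ 0 → d.edge ∈ C.edges ∨ g (M.faceOf d) = 1) :
    ∃ h, coboundary M h = Q ∧ ∀ f, g f = 0 → h f = 0 := by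
  have hG : G.Connected := hT.connected.mono hTG
  obtain ⟨h, hh⟩ := exists_coboundary_eq M hTG hT hM hQ
  suffices hconst : ∃ a, ∀ f, g f = 0 → h f = a by
    obtain ⟨a, ha⟩ := hconst
    refine ⟨h - fun _ => a, ?_, fun f hf => ?_⟩
    · rw [map_sub, coboundary_const, hh, sub_zero]
    · rw [Pi.sub_apply, ha f hf, sub_self]
  -- Cutting `h` off inside the cycle leaves a boundary supported on `C`, since `Q` has no edge
  -- strictly outside.
  let w : M.Face → ZMod 2 := fun f => if g f = 0 then h f else 0
  have hw : ∀ x ∉ C.edges, coboundary M w x = 0 := by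
    intro x hx
    by_cases hxG : x ∈ G.edgeSet
    swap
    · exact (coboundary_mem_evenSpace M w).2 x hxG
    induction x with | _ a b
    let d : G.Dart := ⟨(a, b), hxG⟩
    have h1 : g (M.faceOf d) = g (M.faceOf d.symm) := by
      rw [eq_iff_coboundary_edge_eq_zero, hg, vec_apply, if_neg]
      exact hx
    refine (eq_iff_coboundary_edge_eq_zero M w d).1 ?_
    simp only [w, ← h1]
    by_cases h2 : g (M.faceOf d) = 0
    · rw [if_pos h2, if_pos h2, eq_iff_coboundary_edge_eq_zero, hh]
      by_contra h3
      rcases hQC d h3 with h4 | h4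
      · exact hx h4
      · rw [h2] at h4
        exact zero_ne_one h4
    · rw [if_neg h2, if_neg h2]
  obtain ⟨f₁, hf₁⟩ := hin
  have hw₁ : w f₁ = 0 := if_neg (by rw [hf₁]; exact one_ne_zero)
  have hwT : ∀ x, NonTree G T x → x ≠ e → coboundary M w x = 0 := fun x hx hxe =>
    hw x fun h => (hC.2 x h).elim hx.2 hxe
  -- The only non-tree edge of `C` is `e`, so the boundary of `w` is empty or all of `C`.
  -- Accordingly `w` or `w - g` is constant, which makes `h` constant on the outer faces.
  rcases zmod_two_cases (coboundary M w e) with h0 | h1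
  · have hz : coboundary M w = 0 := eq_zero_of_nonTree_eq_zero hT.isAcyclic
      (coboundary_mem_evenSpace M w) fun x hx => by
        by_cases hxe : x = e
        · rw [hxe, h0]
        · exact hwT x hx hxe
    refine ⟨0, fun f hf => ?_⟩
    have := eq_of_coboundary_eq_zero M hG hz f f₁
    rw [hw₁] at this
    simpa only [w, if_pos hf] using this
  · have hz : coboundary M (w - g) = 0 := by
      rw [map_sub, sub_eq_zero, hg]
      refine eq_of_eq_on_nonTree hT.isAcyclic (coboundary_mem_evenSpace M w)
        (vec_cycle_mem_evenSpace hC.1) fun x hx => ?_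
      rw [vec_isFundCycle_apply hT.isAcyclic hC hx]
      split_ifs with hxe
      · rw [hxe, h1]
      · exact hwT x hx hxe
    refine ⟨(w - g) f₁, fun f hf => ?_⟩
    rw [← eq_of_coboundary_eq_zero M hG hz f f₁, Pi.sub_apply, hf, sub_zero]
    exact (if_pos hf).symm

/-- As no boundary edge meets `v`, the value of `h` is the same on all faces around `v`. One of
these faces is outer, because an edge of `C` at `v` has an outer face on one side. -/
theorem inner_coboundary_eq_zero_at (hC : C.IsCycle)
    (hg : coboundary M g = vec {x | x ∈ C.edges}) {h : M.Face → ZMod 2}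
    (hgh : ∀ f, g f = 0 → h f = 0) {v : V} (hv : v ∈ C.support)
    (hQ : ∀ x, v ∈ x → coboundary M h x = 0) {d : G.Dart} (hd : d.fst = v) :
    h (M.faceOf d) = 0 := by
  obtain ⟨i, hi, rfl⟩ := exists_getVert_eq hC hv
  have hx := getVert_edge_mem C hi
  let d₀ : G.Dart := ⟨(C.getVert i, C.getVert (i + 1)), C.edges_subset_edgeSet hx⟩
  have hat : ∀ d : G.Dart, d.fst = C.getVert i → coboundary M h d.edge = 0 := fun d hd =>
    hQ _ (hd ▸ Sym2.mem_mk_left _ _)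
  rw [eq_of_fst_eq M hat hd (rfl : d₀.fst = _)]
  have h1 : g (M.faceOf d₀) + g (M.faceOf d₀.symm) = 1 := by
    rw [← coboundary_edge, hg, vec_apply, if_pos]
    exact hx
  rcases zmod_two_cases (g (M.faceOf d₀)) with h | h
  · exact hgh _ h
  · rw [(eq_iff_coboundary_edge_eq_zero M _ d₀).2 (hat d₀ rfl)]
    refine hgh _ ?_
    rw [h] at h1
    simpa using h1

/-- An even subgraph made of edges of the cycle and of one inner bridge bounds a set of inner faces
that avoids every other bridge with a point of attachment off the subgraph. -/
theorem exists_inner_coboundary_avoiding (hTG : T ≤ G) (hT : T.IsTree) (hM : M.Planar)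
    (hC : IsFundCycle T e C) (hg : coboundary M g = vec {x | x ∈ C.edges})
    {B₁ B₂ : Bridge C} (hB : B₁ ≠ B₂) (h₁ : ∀ d : G.Dart, d.edge ∈ B₁.edges → g (M.faceOf d) = 1)
    (h₂ : ∀ d : G.Dart, d.edge ∈ B₂.edges → g (M.faceOf d) = 1)
    {q : Sym2 V → ZMod 2} (hq : ∀ x, q x ≠ 0 → x ∈ B₁.edges)
    {I : Finset ℕ} (hI : ∀ k ∈ I, k < C.length) (hQ : boundary G (q + arc C I) = 0)
    {v : V} (hv : v ∈ B₂.attachments) (hqv : ∀ x, v ∈ x → q x = 0)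
    (hIv : ∀ x, v ∈ x → arc C I x = 0) :
    ∃ h, coboundary M h = q + arc C I ∧ (∀ f, g f = 0 → h f = 0) ∧
      ∀ d : G.Dart, d.edge ∈ B₂.edges → h (M.faceOf d) = 0 := by
  have hsupp : ∀ x, (q + arc C I) x ≠ 0 → x ∈ B₁.edges ∨ x ∈ C.edges := by
    intro x hx
    by_contra! hcon
    refine hx ?_
    have h1 : q x = 0 := by_contra fun h => hcon.1 (hq x h)
    have h2 : arc C I x = 0 := by_contra fun h => hcon.2 (mem_edges_of_arc_ne_zero hI h)
    rw [Pi.add_apply, h1, h2, add_zero]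
  have heven : q + arc C I ∈ evenSpace G := by
    refine ⟨hQ, fun x hx => by_contra fun h => ?_⟩
    exact (hsupp x h).elim (fun h => hx (Bridge.mem_edgeSet h))
      fun h => hx (C.edges_subset_edgeSet h)
  obtain ⟨d₂, hd₂, hdB₂⟩ := Bridge.exists_dart_of_mem_attachments hv
  obtain ⟨h, hh, hgh⟩ := exists_inner_coboundary hTG hT hM hC hg ⟨_, h₂ d₂ hdB₂⟩ heven
    fun d hd => (hsupp _ hd).elim (fun h => Or.inr (h₁ d h)) Or.inl
  refine ⟨h, hh, hgh, fun d hd => ?_⟩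
  have hzero : h (M.faceOf d₂) = 0 := inner_coboundary_eq_zero_at hC.1 hg hgh
    (Bridge.attachments_subset hv)
    (fun x hx => by rw [hh, Pi.add_apply, hqv x hx, hIv x hx, add_zero]) hd₂
  rw [← hzero]
  refine eq_of_mem_bridge_edges M (fun x hx => ?_) hd hdB₂
  rw [hh]
  by_contra hne
  exact (hsupp x hne).elim (fun h => hB (Bridge.eq_of_mem_edges h hx)) (Bridge.notMem_cycle hx)

/-- A chain `q` through `B₁` closes up with either arc between its ends. The two closed chains bound
inner sets `h` and `h'` whose sum is the whole inside. Each arc misses a point of attachment of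
`B₂`, so both sets avoid `B₂`, although `B₂` is inside. -/
theorem not_interleave_of_inner (hTG : T ≤ G) (hT : T.IsTree) (hM : M.Planar)
    (hC : IsFundCycle T e C) (hg : coboundary M g = vec {x | x ∈ C.edges})
    {B₁ B₂ : Bridge C} (hB : B₁ ≠ B₂) (h₁ : ∀ d : G.Dart, d.edge ∈ B₁.edges → g (M.faceOf d) = 1)
    (h₂ : ∀ d : G.Dart, d.edge ∈ B₂.edges → g (M.faceOf d) = 1) :
    ¬ Interleave C B₁.attachments B₂.attachments := by
  rintro ⟨i, j, k, l, hij, hjk, hkl, hl, hi1, hj2, hk1, hl2⟩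
  have hne : ∀ {a b : ℕ}, a < C.length → b < C.length → a ≠ b → C.getVert a ≠ C.getVert b :=
    fun ha hb hab h => hab ((getVert_eq_iff hC.1 ha hb).1 h)
  obtain ⟨q, hq, hqv, hqb⟩ := exists_chain_through_bridge B₁ hi1 hk1
    (hne (by omega) (by omega) (by omega))
  have hqz : ∀ m < C.length, m ≠ i → m ≠ k → ∀ x, C.getVert m ∈ x → q x = 0 := by
    intro m hm hmi hmk x hx
    by_contra h
    exact (hqv x h _ (C.getVert_mem_support m) hx).elim (hne hm (by omega) hmi)
      (hne hm (by omega) hmk)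
  have hI : ∀ m ∈ Finset.Ico i k, m < C.length := fun m hm => by
    rw [Finset.mem_Ico] at hm; omega
  have hI' : ∀ m ∈ Finset.range C.length \ Finset.Ico i k, m < C.length := fun m hm => by
    rw [Finset.mem_sdiff, Finset.mem_range] at hm; exact hm.1
  have hb1 : boundary G (q + arc C (Finset.Ico i k)) = 0 := by
    rw [map_add, hqb, boundary_arc_Ico C (by omega) (by omega), add_self_zmod_two]
  have hsum : q + arc C (Finset.range C.length \ Finset.Ico i k) =
      (q + arc C (Finset.Ico i k)) + vec {x | x ∈ C.edges} := by
    rw [arc_sdiff hC.1 hI]; abel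
  have hb2 : boundary G (q + arc C (Finset.range C.length \ Finset.Ico i k)) = 0 := by
    rw [hsum, map_add, hb1, (vec_cycle_mem_evenSpace hC.1).1, add_zero]
  obtain ⟨h, hh, hgh, hhB⟩ := exists_inner_coboundary_avoiding hTG hT hM hC hg hB h₁ h₂ hq hI hb1
    hl2 (hqz l (by omega) (by omega) (by omega)) fun x hx => arc_apply_eq_zero hC.1 hI hl
      (fun m hm => by rw [Finset.mem_Ico] at hm; omega) hx
  obtain ⟨h', hh', hgh', hhB'⟩ := exists_inner_coboundary_avoiding hTG hT hM hC hg hB h₁ h₂ hq hI'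
    hb2 hj2 (hqz j (by omega) (by omega) (by omega)) fun x hx =>
      arc_apply_eq_zero hC.1 hI' (by omega)
        (fun m hm => by
          rw [Finset.mem_sdiff, Finset.mem_range, Finset.mem_Ico] at hm; omega) hx
  have hG : G.Connected := hT.connected.mono hTG
  have hkey : h + h' = g := eq_of_coboundary_eq_of_le hG hC.1 hg
    (by rw [map_add, hh, hh', hsum, ← add_assoc, add_self_zmod_two, zero_add])
    fun f hf => by rw [Pi.add_apply, hgh f hf, hgh' f hf, add_zero]
  obtain ⟨d, -, hd⟩ := Bridge.exists_dart_of_mem_attachments hj2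
  have := congrFun hkey (M.faceOf d)
  rw [Pi.add_apply, hhB d hd, hhB' d hd, h₂ d hd, add_zero] at this
  exact zero_ne_one this

/-- A chord has only two ends, so `B₁` is a component and contains a tripod to the three points. Its
legs, taken in pairs, close up with the three arcs. Each closed chain misses one of the points and
so bounds an inner set avoiding `B₂`, yet the three sets add up to the whole inside. -/
theorem not_three_common_of_inner (hTG : T ≤ G) (hT : T.IsTree) (hM : M.Planar)
    (hC : IsFundCycle T e C) (hg : coboundary M g = vec {x | x ∈ C.edges})
    {B₁ B₂ : Bridge C} (hB : B₁ ≠ B₂) (h₁ : ∀ d : G.Dart, d.edge ∈ B₁.edges → g (M.faceOf d) = 1)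
    (h₂ : ∀ d : G.Dart, d.edge ∈ B₂.edges → g (M.faceOf d) = 1) {i j k : ℕ} (hij : i < j)
    (hjk : j < k) (hk : k < C.length) (hi1 : C.getVert i ∈ B₁.attachments)
    (hi2 : C.getVert i ∈ B₂.attachments) (hj1 : C.getVert j ∈ B₁.attachments)
    (hj2 : C.getVert j ∈ B₂.attachments) (hk1 : C.getVert k ∈ B₁.attachments)
    (hk2 : C.getVert k ∈ B₂.attachments) : False := by
  have hne : ∀ {a b : ℕ}, a < C.length → b < C.length → a ≠ b → C.getVert a ≠ C.getVert b :=
    fun ha hb hab h => hab ((getVert_eq_iff hC.1 ha hb).1 h)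
  rcases B₁ with X | ⟨y, hy⟩
  swap
  · have : y = s(C.getVert i, C.getVert j) :=
      (Sym2.mem_and_mem_iff (hne (by omega) (by omega) (by omega))).1 ⟨hi1, hj1⟩
    subst this
    exact (Sym2.mem_iff.1 hk1).elim (hne hk (by omega) (by omega)) (hne hk (by omega) (by omega))
  obtain ⟨x₀, hX⟩ := exists_chain_to_component X
  obtain ⟨p, hp, hpv, hpb⟩ := hX _ hi1
  obtain ⟨q, hq, hqv, hqb⟩ := hX _ hj1
  obtain ⟨r, hr, hrv, hrb⟩ := hX _ hk1
  have hz : ∀ {t : Sym2 V → ZMod 2} {n : ℕ}, n < C.length →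
      (∀ x, t x ≠ 0 → ∀ v ∈ C.support, v ∈ x → v = C.getVert n) →
      ∀ m < C.length, m ≠ n → ∀ x, C.getVert m ∈ x → t x = 0 := by
    intro t n hn ht m hm hmn x hx
    by_contra h
    exact hne hm hn hmn (ht x h _ (C.getVert_mem_support m) hx)
  have hadd : ∀ {s t : Sym2 V → ZMod 2},
      (∀ x, s x ≠ 0 → x ∈ Bridge.edges (Sum.inl X : Bridge C)) →
      (∀ x, t x ≠ 0 → x ∈ Bridge.edges (Sum.inl X : Bridge C)) →
      ∀ x, (s + t) x ≠ 0 → x ∈ Bridge.edges (Sum.inl X : Bridge C) := by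
    intro s t hs ht x hx
    by_contra hcon
    refine hx ?_
    rw [Pi.add_apply, by_contra fun h => hcon (hs x h), by_contra fun h => hcon (ht x h),
      add_zero]
  have hcomb : ∀ a b c : V → ZMod 2, (a + c) + (b + c) + (a + b) = 0 := by
    intro a b c
    calc _ = (a + a) + (b + b) + (c + c) := by abel
      _ = 0 := by simp [add_self_zmod_two]
  have hI : ∀ {a b : ℕ}, b ≤ C.length → ∀ m ∈ Finset.Ico a b, m < C.length := fun hb m hm => by
    rw [Finset.mem_Ico] at hm; omega
  have hI' : ∀ m ∈ Finset.range C.length \ Finset.Ico i k, m < C.length := fun m hm => by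
    rw [Finset.mem_sdiff, Finset.mem_range] at hm; exact hm.1
  have hb1 : boundary G ((p + q) + arc C (Finset.Ico i j)) = 0 := by
    rw [map_add, map_add, hpb, hqb, boundary_arc_Ico C (by omega) (by omega), hcomb]
  have hb2 : boundary G ((q + r) + arc C (Finset.Ico j k)) = 0 := by
    rw [map_add, map_add, hqb, hrb, boundary_arc_Ico C (by omega) (by omega), hcomb]
  have hsum : (p + r) + arc C (Finset.range C.length \ Finset.Ico i k) =
      ((p + q) + arc C (Finset.Ico i j)) + ((q + r) + arc C (Finset.Ico j k)) +
        vec {x | x ∈ C.edges} := by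
    rw [arc_sdiff hC.1 (hI (by omega)), ← Finset.Ico_union_Ico_eq_Ico hij.le hjk.le,
      arc_union C (Finset.Ico_disjoint_Ico_consecutive i j k)]
    calc _ = (p + r + (vec {x | x ∈ C.edges} + (arc C (Finset.Ico i j) +
          arc C (Finset.Ico j k)))) + (q + q) := by rw [add_self_zmod_two, add_zero]
      _ = _ := by abel
  have hb3 : boundary G ((p + r) + arc C (Finset.range C.length \ Finset.Ico i k)) = 0 := by
    rw [hsum, map_add, map_add, hb1, hb2, (vec_cycle_mem_evenSpace hC.1).1, add_zero, add_zero]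
  have hvan : ∀ {s t : Sym2 V → ZMod 2} {v : V}, (∀ x, v ∈ x → s x = 0) → (∀ x, v ∈ x → t x = 0) →
      ∀ x, v ∈ x → (s + t) x = 0 := fun hs ht x hx => by
    rw [Pi.add_apply, hs x hx, ht x hx, add_zero]
  obtain ⟨h, hh, hgh, hhB⟩ := exists_inner_coboundary_avoiding hTG hT hM hC hg hB h₁ h₂
    (hadd hp hq) (hI (by omega)) hb1 hk2
    (hvan (hz (by omega) hpv k (by omega) (by omega)) (hz (by omega) hqv k (by omega) (by omega)))
    fun x hx => arc_apply_eq_zero hC.1 (hI (by omega)) hk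
      (fun m hm => by rw [Finset.mem_Ico] at hm; omega) hx
  obtain ⟨h', hh', hgh', hhB'⟩ := exists_inner_coboundary_avoiding hTG hT hM hC hg hB h₁ h₂
    (hadd hq hr) (hI (by omega)) hb2 hi2
    (hvan (hz (by omega) hqv i (by omega) (by omega)) (hz (by omega) hrv i (by omega) (by omega)))
    fun x hx => arc_apply_eq_zero hC.1 (hI (by omega)) (by omega)
      (fun m hm => by rw [Finset.mem_Ico] at hm; omega) hx
  obtain ⟨h'', hh'', hgh'', hhB''⟩ := exists_inner_coboundary_avoiding hTG hT hM hC hg hB h₁ h₂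
    (hadd hp hr) hI' hb3 hj2
    (hvan (hz (by omega) hpv j (by omega) (by omega)) (hz (by omega) hrv j (by omega) (by omega)))
    fun x hx => arc_apply_eq_zero hC.1 hI' (by omega)
      (fun m hm => by rw [Finset.mem_sdiff, Finset.mem_range, Finset.mem_Ico] at hm; omega) hx
  have hG : G.Connected := hT.connected.mono hTG
  have hkey : h + h' + h'' = g := eq_of_coboundary_eq_of_le hG hC.1 hg
    (by rw [map_add, map_add, hh, hh', hh'', hsum, ← add_assoc, add_self_zmod_two, zero_add])
    fun f hf => by rw [Pi.add_apply, Pi.add_apply, hgh f hf, hgh' f hf, hgh'' f hf]; rfl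
  obtain ⟨d, -, hd⟩ := Bridge.exists_dart_of_mem_attachments hj2
  have := congrFun hkey (M.faceOf d)
  rw [Pi.add_apply, Pi.add_apply, hhB d hd, hhB' d hd, hhB'' d hd, h₂ d hd] at this
  simp at this

/-- Conflicting bridges of a fundamental cycle lie on different sides of it. -/
theorem ne_of_conflict (hTG : T ≤ G) (hT : T.IsTree) (hM : M.Planar)
    (hC : IsFundCycle T e C) (hg : coboundary M g = vec {x | x ∈ C.edges})
    {B₁ B₂ : Bridge C} (hB : B₁ ≠ B₂) (hconf : Conflict C B₁ B₂) {d₁ d₂ : G.Dart}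
    (hd₁ : d₁.edge ∈ B₁.edges) (hd₂ : d₂.edge ∈ B₂.edges) :
    g (M.faceOf d₁) ≠ g (M.faceOf d₂) := by
  intro heq
  have hcon : ∀ B : Bridge C, ∀ x ∈ B.edges, coboundary M g x = 0 := fun B x hx => by
    rw [hg, vec_apply, if_neg]
    exact Bridge.notMem_cycle hx
  -- Adding a constant keeps the boundary and turns the common side of the two bridges into the
  -- inner one.
  let g' : M.Face → ZMod 2 := g + fun _ => g (M.faceOf d₁) + 1
  have hg' : coboundary M g' = vec {x | x ∈ C.edges} := by
    rw [map_add, coboundary_const, add_zero, hg]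
  have h1 : ∀ f, g f = g (M.faceOf d₁) → g' f = 1 := by
    intro f hf
    show g f + (g (M.faceOf d₁) + 1) = 1
    rw [hf, ← add_assoc, CharTwo.add_self_eq_zero, zero_add]
  have h₁ : ∀ d : G.Dart, d.edge ∈ B₁.edges → g' (M.faceOf d) = 1 := fun d hd =>
    h1 _ (eq_of_mem_bridge_edges M (hcon B₁) hd hd₁)
  have h₂ : ∀ d : G.Dart, d.edge ∈ B₂.edges → g' (M.faceOf d) = 1 := fun d hd =>
    h1 _ ((eq_of_mem_bridge_edges M (hcon B₂) hd hd₂).trans heq.symm)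
  rcases hconf with h | h | ⟨a, b, c, hab, hac, hbc, habc⟩
  · exact not_interleave_of_inner hTG hT hM hC hg' hB h₁ h₂ h
  · exact not_interleave_of_inner hTG hT hM hC hg' hB.symm h₂ h₁ h
  · obtain ⟨i, j, k, hij, hjk, hk, hi, hj, hk'⟩ := exists_three_positions hC.1
      (A := B₁.attachments ∩ B₂.attachments) (fun a ha => Bridge.attachments_subset ha.1)
      (habc (by simp)) (habc (by simp)) (habc (by simp)) hab hac hbc
    exact not_three_common_of_inner hTG hT hM hC hg' hB h₁ h₂ hij hjk hk hi.1 hi.2 hj.1 hj.2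
      hk'.1 hk'.2

end Jordan

/-! ### 3-connectedness makes the conflict graph connected. -/

section ConflictConnected

variable {V : Type*} [Fintype V] {G : SimpleGraph V} {u : V} {C : G.Walk u u}

theorem ThreeConnected.of_closed (hG : ThreeConnected G) {S : Finset V} (hS : S.card < 3)
    {W : V → Prop} (hW : ∀ v w, W v → G.Adj v w → w ∉ S → W w) {a b : V} (ha : a ∉ S)
    (hb : b ∉ S) (hWa : W a) : W b := by
  obtain ⟨p⟩ := (hG.2 S hS).preconnected ⟨a, ha⟩ ⟨b, hb⟩
  have key : ∀ (x y : {v : V | v ∉ S}), (G.induce {v : V | v ∉ S}).Walk x y → W x → W y := by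
    intro x y p
    induction p with
    | nil => exact id
    | @cons x y z h p ih => exact fun hx => ih (hW x y hx h y.2)
  exact key _ _ p hWa

/-- The positions of the points of attachment of a bridge along the cycle. -/
def Bridge.positions (B : Bridge C) : Set ℕ := {i | i < C.length ∧ C.getVert i ∈ B.attachments}

/-- With at most two points of attachment, deleting them would separate the component from a
remaining vertex of the cycle, which has at least three. -/
theorem Bridge.exists_three_positions (hG : ThreeConnected G) (hC : C.IsCycle)
    (X : (G.induce {v : V | v ∉ C.support}).ConnectedComponent) :
    ∃ i j k, i < j ∧ j < k ∧ i ∈ Bridge.positions (Sum.inl X : Bridge C) ∧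
      j ∈ Bridge.positions (Sum.inl X : Bridge C) ∧
      k ∈ Bridge.positions (Sum.inl X : Bridge C) := by
  let S : Finset V := Finset.univ.filter (· ∈ Bridge.attachments (Sum.inl X : Bridge C))
  have h3 := hC.three_le_length
  have hS : 2 < S.card := by
    by_contra hlt
    have hcard : (Finset.image C.getVert (Finset.range 3)).card = 3 := by
      rw [Finset.card_image_of_injOn, Finset.card_range]
      intro a ha b hb hab
      rw [Finset.mem_coe, Finset.mem_range] at ha hb
      exact (getVert_eq_iff hC (by omega) (by omega)).1 hab
    obtain ⟨c, hc, hcS⟩ := Finset.exists_mem_notMem_of_card_lt_card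
      (show S.card < (Finset.image C.getVert (Finset.range 3)).card by omega)
    obtain ⟨m, -, rfl⟩ := Finset.mem_image.1 hc
    induction X using SimpleGraph.ConnectedComponent.ind with | _ x
    let W : V → Prop := fun v => ∃ h : v ∉ C.support,
      (G.induce {v : V | v ∉ C.support}).connectedComponentMk ⟨v, h⟩ =
        (G.induce {v : V | v ∉ C.support}).connectedComponentMk x
    have hW : ∀ v w, W v → G.Adj v w → w ∉ S → W w := by
      rintro v w ⟨hv, hvx⟩ hvw hw
      by_cases hwC : w ∈ C.support
      · exact absurd (Finset.mem_filter.2 ⟨Finset.mem_univ _, hwC, ⟨v, hv⟩, hvx, hvw⟩) hw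
      · refine ⟨hwC, ?_⟩
        rw [← hvx, SimpleGraph.ConnectedComponent.eq]
        exact (SimpleGraph.Adj.reachable
          (show (G.induce {v : V | v ∉ C.support}).Adj ⟨v, hv⟩ ⟨w, hwC⟩ from hvw)).symm
    obtain ⟨hm, -⟩ : W (C.getVert m) := hG.of_closed (S := S) (by omega) hW (a := x)
      (fun h => x.2 (Finset.mem_filter.1 h).2.1) hcS ⟨x.2, rfl⟩
    exact hm (C.getVert_mem_support m)
  obtain ⟨a, ha, b, hb, c, hc, hab, hac, hbc⟩ := Finset.two_lt_card.1 hS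
  obtain ⟨i, j, k, hij, hjk, hk, h1, h2, h3⟩ := PlanarBasis.exists_three_positions hC
    (A := Bridge.attachments (Sum.inl X : Bridge C)) (fun a ha => Bridge.attachments_subset ha)
    (Finset.mem_filter.1 ha).2 (Finset.mem_filter.1 hb).2 (Finset.mem_filter.1 hc).2 hab hac hbc
  exact ⟨i, j, k, hij, hjk, ⟨by omega, h1⟩, ⟨by omega, h2⟩, ⟨hk, h3⟩⟩

/-- The ends of a chord are not consecutive on `C`, also not across the base vertex, since otherwise
the chord would be an edge of `C`. -/
theorem Bridge.exists_chord_positions (hC : C.IsCycle)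
    (y : {x : Sym2 V // x ∈ G.edgeSet ∧ x ∉ C.edges ∧ ∀ v ∈ x, v ∈ C.support}) :
    ∃ p q, p + 1 < q ∧ ¬ (p = 0 ∧ q + 1 = C.length) ∧
      p ∈ Bridge.positions (Sum.inr y : Bridge C) ∧
      q ∈ Bridge.positions (Sum.inr y : Bridge C) := by
  obtain ⟨y, hyG, hyC, hy⟩ := y
  induction y with | _ a b
  obtain ⟨p, hp, rfl⟩ := exists_getVert_eq hC (hy a (Sym2.mem_mk_left _ _))
  obtain ⟨q, hq, rfl⟩ := exists_getVert_eq hC (hy b (Sym2.mem_mk_right _ _))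
  have hcons : ∀ i < C.length, ∀ j, C.getVert (i + 1) = C.getVert j →
      s(C.getVert i, C.getVert j) ∈ C.edges := fun i hi j hij => hij ▸ getVert_edge_mem C hi
  have hne : p ≠ q := fun h => G.loopless.irrefl _ (by rw [h] at hyG; exact hyG)
  have hclose : ∀ i j, i < C.length → j < C.length →
      s(C.getVert i, C.getVert j) ∉ C.edges → i + 1 ≠ j ∧ ¬ (i + 1 = C.length ∧ j = 0) := by
    intro i j hi hj hij
    have := mt (hcons i hi j) hij
    rw [getVert_succ_eq_iff hC hi hj] at this
    tauto
  have h1 := hclose p q hp hq hyC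
  have h2 := hclose q p hq hp (by rwa [Sym2.eq_swap])
  have ha : C.getVert p ∈ Bridge.attachments
      (Sum.inr ⟨s(C.getVert p, C.getVert q), hyG, hyC, hy⟩ : Bridge C) := Sym2.mem_mk_left _ _
  have hb : C.getVert q ∈ Bridge.attachments
      (Sum.inr ⟨s(C.getVert p, C.getVert q), hyG, hyC, hy⟩ : Bridge C) := Sym2.mem_mk_right _ _
  rcases lt_or_gt_of_ne hne with h | h
  · exact ⟨p, q, by omega, by omega, ⟨hp, ha⟩, ⟨hq, hb⟩⟩
  · exact ⟨q, p, by omega, by omega, ⟨hq, hb⟩, ⟨hp, ha⟩⟩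

theorem Bridge.exists_two_positions (hG : ThreeConnected G) (hC : C.IsCycle) (B : Bridge C) :
    ∃ p q, p < q ∧ p ∈ B.positions ∧ q ∈ B.positions := by
  rcases B with X | y
  · obtain ⟨i, j, k, hij, hjk, hi, hj, hk⟩ := Bridge.exists_three_positions hG hC X
    exact ⟨i, j, hij, hi, hj⟩
  · obtain ⟨p, q, hpq, -, hp, hq⟩ := Bridge.exists_chord_positions hC y
    exact ⟨p, q, by omega, hp, hq⟩

theorem interleave_of_positions {B B' : Bridge C} {i j k l : ℕ} (hij : i < j) (hjk : j < k)
    (hkl : k < l) (hi : i ∈ B.positions) (hj : j ∈ B'.positions) (hk : k ∈ B.positions)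
    (hl : l ∈ B'.positions) : Interleave C B.attachments B'.attachments :=
  ⟨i, j, k, l, hij, hjk, hkl, hl.1, hi.2, hj.2, hk.2, hl.2⟩

theorem conflict_of_three_positions (hC : C.IsCycle) {B B' : Bridge C} {i j k : ℕ} (hij : i < j)
    (hjk : j < k) (hi : i ∈ B.positions) (hj : j ∈ B.positions) (hk : k ∈ B.positions)
    (hi' : i ∈ B'.positions) (hj' : j ∈ B'.positions) (hk' : k ∈ B'.positions) :
    Conflict C B B' := by
  refine Or.inr (Or.inr ⟨C.getVert i, C.getVert j, C.getVert k, ?_, ?_, ?_, ?_⟩)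
  · rw [Ne, getVert_eq_iff hC hi.1 hj.1]; omega
  · rw [Ne, getVert_eq_iff hC hi.1 hk.1]; omega
  · rw [Ne, getVert_eq_iff hC hj.1 hk.1]; omega
  · rintro x (rfl | rfl | rfl)
    exacts [⟨hi.2, hi'.2⟩, ⟨hj.2, hj'.2⟩, ⟨hk.2, hk'.2⟩]

theorem positions_of_conflict (hC : C.IsCycle) {B B' : Bridge C} (h : Conflict C B B') :
    ∃ i j k, i < j ∧ j < k ∧
      ((∃ l, k < l ∧ i ∈ B.positions ∧ j ∈ B'.positions ∧ k ∈ B.positions ∧ l ∈ B'.positions) ∨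
      (∃ l, k < l ∧ i ∈ B'.positions ∧ j ∈ B.positions ∧ k ∈ B'.positions ∧ l ∈ B.positions) ∨
      (i ∈ B.positions ∧ j ∈ B.positions ∧ k ∈ B.positions ∧
        i ∈ B'.positions ∧ j ∈ B'.positions ∧ k ∈ B'.positions)) := by
  rcases h with ⟨i, j, k, l, hij, hjk, hkl, hl, h1, h2, h3, h4⟩ |
    ⟨i, j, k, l, hij, hjk, hkl, hl, h1, h2, h3, h4⟩ | ⟨a, b, c, hab, hac, hbc, habc⟩
  · exact ⟨i, j, k, hij, hjk, Or.inl ⟨l, hkl, ⟨by omega, h1⟩, ⟨by omega, h2⟩, ⟨by omega, h3⟩,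
      ⟨hl, h4⟩⟩⟩
  · exact ⟨i, j, k, hij, hjk, Or.inr (Or.inl ⟨l, hkl, ⟨by omega, h1⟩, ⟨by omega, h2⟩,
      ⟨by omega, h3⟩, ⟨hl, h4⟩⟩)⟩
  · obtain ⟨i, j, k, hij, hjk, hk, hi, hj, hk'⟩ := exists_three_positions hC
      (A := B.attachments ∩ B'.attachments) (fun a ha => Bridge.attachments_subset ha.1)
      (habc (by simp)) (habc (by simp)) (habc (by simp)) hab hac hbc
    exact ⟨i, j, k, hij, hjk, Or.inr (Or.inr ⟨⟨by omega, hi.1⟩, ⟨by omega, hj.1⟩, ⟨hk, hk'.1⟩,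
      ⟨by omega, hi.2⟩, ⟨by omega, hj.2⟩, ⟨hk, hk'.2⟩⟩)⟩

/-- A bridge without conflict with a connected set of bridges does not separate their points of
attachment. -/
theorem positions_on_one_side (hC : C.IsCycle) {B₀ B : Bridge C}
    (hB : ¬ (conflictGraph C).Reachable B₀ B) {p q : ℕ} (hp : p ∈ B.positions)
    (hq : q ∈ B.positions) {K K' : Bridge C} (hK : (conflictGraph C).Reachable B₀ K)
    (hK' : (conflictGraph C).Reachable B₀ K') {a b : ℕ} (ha : a ∈ K.positions) (hpa : p < a)
    (haq : a < q) (hb : b ∈ K'.positions) : p ≤ b ∧ b ≤ q := by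
  have hno : ∀ L, (conflictGraph C).Reachable B₀ L → ¬ Conflict C L B := fun L hL hconf =>
    hB (hL.trans (SimpleGraph.Adj.reachable ⟨fun h => hB (h ▸ hL), hconf⟩))
  -- A bridge attached both strictly between `p` and `q` and beyond them would interleave with `B`.
  have hin : ∀ L, (conflictGraph C).Reachable B₀ L → (∃ a ∈ L.positions, p < a ∧ a < q) →
      ∀ b ∈ L.positions, p ≤ b ∧ b ≤ q := by
    rintro L hL ⟨a, ha, hpa, haq⟩ b hb
    by_contra hcon
    rcases lt_or_ge b p with h | h
    · exact hno L hL (Or.inl (interleave_of_positions h hpa haq hb hp ha hq))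
    · exact hno L hL (Or.inr (Or.inl (interleave_of_positions hpa haq (by omega) hp ha hq hb)))
  suffices h : ∃ a ∈ K'.positions, p < a ∧ a < q from hin K' hK' h b hb
  obtain ⟨w⟩ := hK.symm.trans hK'
  clear hK' hb b
  induction w generalizing a with
  | nil => exact ⟨a, ha, hpa, haq⟩
  | @cons K L K' hadj w ih =>
    have hL := hK.trans (SimpleGraph.Adj.reachable hadj)
    have hKin := hin K hK ⟨a, ha, hpa, haq⟩
    suffices h : ∃ a ∈ L.positions, p < a ∧ a < q by
      obtain ⟨a', ha', h1, h2⟩ := h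
      exact ih hL ha' h1 h2
    -- Either kind of conflict puts a position of `L` strictly between two positions of `K`, and
    -- these lie in `[p, q]`.
    by_contra! hcon
    obtain ⟨i, j, k, hij, hjk, ⟨l, hkl, h1, h2, h3, h4⟩ | ⟨l, hkl, h1, h2, h3, h4⟩ |
      ⟨h1, h2, h3, h4, h5, h6⟩⟩ := positions_of_conflict hC hadj.2
    · have := hKin i h1; have := hKin k h3; have := hcon j h2; omega
    · have := hKin j h2; have := hKin l h4; have := hcon k h3; omega
    · have := hKin i h1; have := hKin k h3; have := hcon j h5; omega

/-- In a 3-connected graph, a stretch `R` of a cycle cannot be cut off by two vertices of the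
cycle. -/
theorem stretch_spans (hG : ThreeConnected G) (hC : C.IsCycle) {K : Bridge C → Prop}
    {R : ℕ → Prop} {s t : ℕ} (hs : s < C.length) (ht : t < C.length) (hRs : ¬ R s) (hRt : ¬ R t)
    (hRn : ∀ r, R r → r < C.length) (hRK : ∀ B, K B → ∀ r ∈ B.positions, ¬ R r)
    (hsucc : ∀ i j, i < C.length → j < C.length → (i + 1 = j ∨ (i + 1 = C.length ∧ j = 0)) →
      (R i → R j ∨ j = s ∨ j = t) ∧ (R j → R i ∨ i = s ∨ i = t))
    (hB : ∀ B, ¬ K B → ∀ x ∈ B.positions, ∀ y ∈ B.positions, R x → R y ∨ y = s ∨ y = t)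
    {r : ℕ} (hr : R r) :
    (∀ i < C.length, R i ∨ i = s ∨ i = t) ∧ ∀ X, ¬ K (Sum.inl X) := by
  let S : Finset V := {C.getVert s, C.getVert t}
  have hS : S.card < 3 := (Finset.card_insert_le _ _).trans_lt (by simp)
  -- `W` consists of the vertices of the stretch and of the components attached to it. It can be
  -- left only through positions `s` and `t`, so by 3-connectedness it contains every other vertex.
  let W : V → Prop := fun v => (∃ i, R i ∧ C.getVert i = v) ∨ ∃ h : v ∉ C.support, ∃ i, R i ∧
    i ∈ Bridge.positions (Sum.inl ((G.induce {v : V | v ∉ C.support}).connectedComponentMk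
      ⟨v, h⟩) : Bridge C)
  have hnotS : ∀ {j}, C.getVert j ∉ S → R j ∨ j = s ∨ j = t → R j := by
    rintro j hj (h | rfl | rfl)
    · exact h
    · exact absurd (Finset.mem_insert_self _ _) hj
    · exact absurd (Finset.mem_insert_of_mem (Finset.mem_singleton_self _)) hj
  have hW : ∀ v w, W v → G.Adj v w → w ∉ S → W w := by
    rintro v w (⟨i, hi, rfl⟩ | ⟨hv, i, hi, hiX⟩) hvw hw
    · have hin := hRn i hi
      by_cases hwC : w ∈ C.support
      · obtain ⟨j, hj, rfl⟩ := exists_getVert_eq hC hwC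
        refine Or.inl ⟨j, hnotS hw ?_, rfl⟩
        by_cases hedge : s(C.getVert i, C.getVert j) ∈ C.edges
        · obtain ⟨k, hk, hkx⟩ := C.mk_mem_edges_iff_exists.1 hedge
          rcases Sym2.eq_iff.1 hkx with ⟨h1, h2⟩ | ⟨h1, h2⟩
          · rw [getVert_eq_iff hC hk hin] at h1
            rw [getVert_succ_eq_iff hC hk hj] at h2
            subst h1
            exact (hsucc k j hk hj h2).1 hi
          · rw [getVert_eq_iff hC hk hj] at h1
            rw [getVert_succ_eq_iff hC hk hin] at h2
            subst h1
            exact (hsucc k i hk hin h2).2 hi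
        · let B : Bridge C := Sum.inr ⟨s(C.getVert i, C.getVert j), hvw, hedge, fun v hv => by
            rcases Sym2.mem_iff.1 hv with rfl | rfl <;> exact C.getVert_mem_support _⟩
          have hiB : i ∈ B.positions := ⟨hin, Sym2.mem_mk_left _ _⟩
          exact hB B (fun h => hRK B h i hiB hi) i hiB j ⟨hj, Sym2.mem_mk_right _ _⟩ hi
      · exact Or.inr ⟨hwC, i, hi, hin, C.getVert_mem_support i, ⟨w, hwC⟩, rfl, hvw.symm⟩
    · by_cases hwC : w ∈ C.support
      · obtain ⟨j, hj, rfl⟩ := exists_getVert_eq hC hwC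
        refine Or.inl ⟨j, hnotS hw ?_, rfl⟩
        exact hB _ (fun h => hRK _ h i hiX hi) i hiX j ⟨hj, hwC, ⟨v, hv⟩, rfl, hvw⟩ hi
      · refine Or.inr ⟨hwC, i, hi, ?_⟩
        have : (G.induce {v : V | v ∉ C.support}).connectedComponentMk ⟨w, hwC⟩ =
            (G.induce {v : V | v ∉ C.support}).connectedComponentMk ⟨v, hv⟩ :=
          SimpleGraph.ConnectedComponent.eq.2
            (SimpleGraph.Adj.reachable
              (show (G.induce {v : V | v ∉ C.support}).Adj ⟨v, hv⟩ ⟨w, hwC⟩ from hvw)).symm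
        rw [this]
        exact hiX
  have hmem : ∀ {i}, i < C.length → C.getVert i ∈ S → i = s ∨ i = t := by
    intro i hi h
    rw [Finset.mem_insert, Finset.mem_singleton, getVert_eq_iff hC hi hs,
      getVert_eq_iff hC hi ht] at h
    exact h
  have hrS : C.getVert r ∉ S := fun h =>
    (hmem (hRn r hr) h).elim (fun h => hRs (h ▸ hr)) fun h => hRt (h ▸ hr)
  have hall : ∀ v, v ∉ S → W v := fun v hv => hG.of_closed hS hW hrS hv (Or.inl ⟨r, hr, rfl⟩)
  refine ⟨fun i hi => ?_, fun X hX => ?_⟩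
  · by_cases h : C.getVert i ∈ S
    · exact Or.inr (hmem hi h)
    · rcases hall _ h with ⟨j, hj, hji⟩ | ⟨h1, -⟩
      · rw [getVert_eq_iff hC (hRn j hj) hi] at hji
        exact Or.inl (hji ▸ hj)
      · exact absurd (C.getVert_mem_support i) h1
  · induction X using SimpleGraph.ConnectedComponent.ind with | _ x
    have hxS : (x : V) ∉ S := by
      intro h
      rw [Finset.mem_insert, Finset.mem_singleton] at h
      rcases h with h | h <;> exact x.2 (h ▸ C.getVert_mem_support _)
    rcases hall _ hxS with ⟨j, hj, hji⟩ | ⟨h1, i, hi, hiX⟩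
    · exact x.2 (hji ▸ C.getVert_mem_support j)
    · exact hRK _ hX i hiX hi

/-- The conflict graph of a cycle in a 3-connected graph is connected. -/
theorem conflictGraph_preconnected (hG : ThreeConnected G) (hC : C.IsCycle) :
    (conflictGraph C).Preconnected := by
  by_contra hcon
  obtain ⟨B₀, B₁, hB₁⟩ : ∃ B₀ B₁, ¬ (conflictGraph C).Reachable B₀ B₁ := by
    simpa [SimpleGraph.Preconnected] using hcon
  let K : Bridge C → Prop := fun B => (conflictGraph C).Reachable B₀ B
  have hK₀ : K B₀ := SimpleGraph.Reachable.refl _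
  -- The points of attachment of the conflict component `K` of `B₀`; a bridge outside `K` cannot
  -- separate them.
  let A : ℕ → Prop := fun i => ∃ B, K B ∧ i ∈ B.positions
  have hAn : ∀ a, A a → a < C.length := fun a ⟨B, _, h⟩ => h.1
  have hside : ∀ B, ¬ K B → ∀ p ∈ B.positions, ∀ q ∈ B.positions, ∀ a, A a → p < a → a < q →
      ∀ b, A b → p ≤ b ∧ b ≤ q := by
    rintro B hB p hp q hq a ⟨L, hL, ha⟩ hpa haq b ⟨L', hL', hb⟩
    exact positions_on_one_side hC hB hp hq hL hL' ha hpa haq hb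
  have h3 := hC.three_le_length
  obtain ⟨p₀, q₀, hpq₀, hp₀, hq₀⟩ := Bridge.exists_two_positions hG hC B₀
  have hAp : A p₀ := ⟨B₀, hK₀, hp₀⟩
  have hAq : A q₀ := ⟨B₀, hK₀, hq₀⟩
  -- Suppose that `A` is the whole cycle. If `B₁` is a chord, its ends are then forced to be
  -- consecutive. If `B₁` is a component, no position is left between its points of attachment, so
  -- `C` is a triangle; this has no chords, and two components attached to all three vertices
  -- conflict.
  obtain ⟨r, hrn, hrA⟩ : ∃ r < C.length, ¬ A r := by
    by_contra! hall
    rcases B₁ with X | y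
    · obtain ⟨i, j, k, hij, hjk, hi, hj, hk⟩ := Bridge.exists_three_positions hG hC X
      have hkn := hk.1
      have h1 := hside _ hB₁ i hi k hk j (hall j (by omega)) hij hjk
      have h2 := h1 0 (hall 0 (by omega))
      have h4 := h1 (C.length - 1) (hall _ (by omega))
      have h5 : j = i + 1 := by
        by_contra hne
        have := hside _ hB₁ i hi j hj (i + 1) (hall _ (by omega)) (by omega) (by omega) k
          (hall k (by omega))
        omega
      have h6 : k = j + 1 := by
        by_contra hne
        have := hside _ hB₁ j hj k hk (j + 1) (hall _ (by omega)) (by omega) (by omega) i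
          (hall i (by omega))
        omega
      have h7 : C.length = 3 := by omega
      rcases B₀ with X' | y'
      · obtain ⟨i', j', k', hij', hjk', hi', hj', hk'⟩ := Bridge.exists_three_positions hG hC X'
        have hkn' := hk'.1
        have e1 : i' = i := by omega
        have e2 : j' = j := by omega
        have e3 : k' = k := by omega
        subst e1 e2 e3
        refine hB₁ (SimpleGraph.Adj.reachable ⟨fun h => hB₁ (h ▸ hK₀), ?_⟩)
        exact conflict_of_three_positions hC hij hjk hi' hj' hk' hi hj hk
      · obtain ⟨p, q, hpq, hne, hp, hq⟩ := Bridge.exists_chord_positions hC y'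
        have := hq.1
        omega
    · obtain ⟨p, q, hpq, hne, hp, hq⟩ := Bridge.exists_chord_positions hC y
      have hqn := hq.1
      have h1 := hside _ hB₁ p hp q hq (p + 1) (hall _ (by omega)) (by omega) hpq
      have h2 := h1 0 (hall 0 (by omega))
      have h4 := h1 (C.length - 1) (hall _ (by omega))
      omega
  -- Take the maximal stretch around `r` that is free of `A`. It lies between two positions of `A`
  -- in the first case and wraps around the base vertex in the second. Bridges outside `K` attached
  -- to it stay within it and its ends, so `stretch_spans` applies.
  by_cases hbet : (∃ a, A a ∧ a < r) ∧ ∃ b, A b ∧ r < b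
  · obtain ⟨⟨a, ha, har⟩, hb⟩ := hbet
    let s := Nat.findGreatest (fun x => A x ∧ x < r) r
    have hs : A s ∧ s < r := Nat.findGreatest_spec (P := fun x => A x ∧ x < r) har.le ⟨ha, har⟩
    have hsmax : ∀ x, A x → x < r → x ≤ s := fun x hx hxr =>
      Nat.le_findGreatest (P := fun x => A x ∧ x < r) hxr.le ⟨hx, hxr⟩
    let t := Nat.find hb
    have ht : A t ∧ r < t := Nat.find_spec hb
    have htmin : ∀ x, A x → r < x → t ≤ x := fun x hx hxr => Nat.find_min' hb ⟨hx, hxr⟩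
    have hsn := hAn s hs.1
    have htn := hAn t ht.1
    have hAst : ∀ x, A x → ¬ (s < x ∧ x < t) := by
      rintro x hx ⟨h1, h2⟩
      rcases lt_trichotomy x r with h | h | h
      · have := hsmax x hx h; omega
      · exact hrA (h ▸ hx)
      · have := htmin x hx h; omega
    obtain ⟨hspan, hinl⟩ := stretch_spans hG hC (K := K) (R := fun x => s < x ∧ x < t)
      hsn htn (by omega) (by omega) (fun x hx => by omega)
      (fun B hB x hx => hAst x ⟨B, hB, hx⟩) (fun i j hi hj hij => by omega)
      (fun B hB x hx y hy hxR => by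
        by_contra hyR
        rcases lt_or_ge y s with h | h
        · have := hside B hB y hy x hx s hs.1 h hxR.1 t ht.1; omega
        · have := hside B hB x hx y hy t ht.1 hxR.2 (by omega) s hs.1; omega)
      (r := r) ⟨hs.2, ht.2⟩
    -- The stretch and its ends now cover the cycle, so `s` and `t` are the first and the last
    -- position. The ends of the chord `B₀` would be these two consecutive positions.
    rcases B₀ with X | y
    · exact hinl X hK₀
    · obtain ⟨p, q, hpq, hne, hp, hq⟩ := Bridge.exists_chord_positions hC y
      have h1 := hspan 0 (by omega)
      have h2 := hspan (C.length - 1) (by omega)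
      have h4 := hAst p ⟨_, hK₀, hp⟩
      have h5 := hAst q ⟨_, hK₀, hq⟩
      have := hq.1
      omega
  · have hex : ∃ a, A a := ⟨p₀, hAp⟩
    let s := Nat.find hex
    have hs : A s := Nat.find_spec hex
    have hsmin : ∀ x, A x → s ≤ x := fun x hx => Nat.find_min' hex hx
    let t := Nat.findGreatest A C.length
    have ht : A t := Nat.findGreatest_spec (hAn p₀ hAp).le hAp
    have htmax : ∀ x, A x → x ≤ t := fun x hx => Nat.le_findGreatest (hAn x hx).le hx
    have hsn := hAn s hs
    have htn := hAn t ht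
    have hrR : r < s ∨ t < r := by
      by_contra hcon
      have h1 : r ≠ s := fun h => hrA (h ▸ hs)
      have h2 : r ≠ t := fun h => hrA (h ▸ ht)
      exact hbet ⟨⟨s, hs, by omega⟩, ⟨t, ht, by omega⟩⟩
    have hst := hsmin t ht
    obtain ⟨hspan, hinl⟩ := stretch_spans hG hC (K := K)
      (R := fun x => x < C.length ∧ (x < s ∨ t < x))
      hsn htn (by omega) (by omega) (fun x hx => hx.1)
      (fun B hB x hx => by
        have := hsmin x ⟨B, hB, hx⟩; have := htmax x ⟨B, hB, hx⟩; omega)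
      (fun i j hi hj hij => by omega)
      (fun B hB x hx y hy hxR => by
        have hyn := hy.1
        by_contra hyR
        rcases hxR.2 with h | h
        · have := hside B hB x hx y hy s hs h (by omega) t ht; omega
        · have := hside B hB y hy x hx t ht (by omega) h s hs; omega)
      (r := r) ⟨hrn, hrR⟩
    -- Position `p + 1` between the ends of the chord lies strictly between `s` and `t`, so the
    -- wrapping stretch and its ends do not cover it.
    rcases B₀ with X | y
    · exact hinl X hK₀
    · obtain ⟨p, q, hpq, hne, hp, hq⟩ := Bridge.exists_chord_positions hC y
      have hqn := hq.1
      have h1 := hspan (p + 1) (by omega)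
      have h2 := hsmin p ⟨_, hK₀, hp⟩
      have h4 := htmax q ⟨_, hK₀, hq⟩
      omega

end ConflictConnected

/-! ### Every edge has two different faces. -/

section Faces

variable {V : Type*} [Fintype V] {G T : SimpleGraph V} {M : Embedding G}

/-- Any third vertex `w` is joined to `a` after deleting `b`, and to `b` after deleting `a`; neither
connection uses `ab`. -/
theorem ThreeConnected.not_isBridge (hG : ThreeConnected G) (a b : V) : ¬ G.IsBridge s(a, b) := by
  intro h
  rw [SimpleGraph.isBridge_iff] at h
  set G' := G.deleteEdges {s(a, b)}
  obtain ⟨w, hw⟩ : ∃ w, w ∉ ({a, b} : Finset V) := by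
    by_contra! hall
    have h1 := Finset.card_le_card (fun v _ => hall v : Finset.univ ⊆ ({a, b} : Finset V))
    have h2 := Finset.card_le_two (a := a) (b := b)
    have h3 := hG.1
    rw [Finset.card_univ] at h1
    omega
  rw [Finset.mem_insert, Finset.mem_singleton, not_or] at hw
  have hreach : ∀ c d : V, c ≠ d → s(c, d) = s(a, b) → ¬ G'.Reachable c d → w ≠ d →
      G'.Reachable c w := by
    intro c d hcd hs hn hwd
    refine hG.of_closed (S := {d}) (W := fun v => G'.Reachable c v) (by simp) ?_ (a := c)
      (by simpa using hcd) (by simpa using hwd) (SimpleGraph.Reachable.refl _)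
    intro v y hv hvy hy
    refine hv.trans (SimpleGraph.Adj.reachable (SimpleGraph.deleteEdges_adj.2 ⟨hvy, fun h2 => ?_⟩))
    rw [Set.mem_singleton_iff, ← hs] at h2
    have hdv : d ∈ s(v, y) := h2 ▸ Sym2.mem_mk_right _ _
    rcases Sym2.mem_iff.1 hdv with h3 | h3
    · exact hn (h3 ▸ hv)
    · exact hy (by simp [h3])
  have hab : a ≠ b := fun hab => h (hab ▸ SimpleGraph.Reachable.refl _)
  exact h ((hreach a b hab rfl h hw.2).trans
    (hreach b a hab.symm Sym2.eq_swap (fun h2 => h h2.symm) hw.1).symm)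

/-- The edge lies on some cycle, and a set of faces bounded by this cycle contains exactly one of
the two sides. -/
theorem faceOf_ne_faceOf_symm (hG : ThreeConnected G) (hTG : T ≤ G) (hT : T.IsTree)
    (hM : M.Planar) (d : G.Dart) : M.faceOf d ≠ M.faceOf d.symm := by
  intro heq
  have h := hG.not_isBridge d.fst d.snd
  rw [SimpleGraph.isBridge_iff_forall_cycle_notMem d.adj] at h
  push Not at h
  obtain ⟨u, C, hC, hdC⟩ := h
  obtain ⟨g, hg⟩ := exists_coboundary_eq M hTG hT hM (vec_cycle_mem_evenSpace hC)
  have h1 := (eq_iff_coboundary_edge_eq_zero M g d).1 (by rw [heq])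
  rw [hg, vec_apply, if_pos (show d.edge ∈ {x | x ∈ C.edges} from hdC)] at h1
  exact one_ne_zero h1

theorem mem_faceEdges {f : M.Face} {d : G.Dart} :
    d.edge ∈ M.faceEdges f ↔ M.faceOf d = f ∨ M.faceOf d.symm = f := by
  constructor
  · rintro ⟨d', hd', hdd⟩
    rcases (SimpleGraph.dart_edge_eq_iff d' d).1 hdd with rfl | rfl
    · exact Or.inl hd'
    · exact Or.inr hd'
  · rintro (h | h)
    · exact ⟨d, h, rfl⟩
    · exact ⟨d.symm, h, d.edge_symm⟩

theorem exists_dart_edge_eq {x : Sym2 V} (hx : x ∈ G.edgeSet) : ∃ d : G.Dart, d.edge = x := by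
  induction x with | _ a b
  exact ⟨⟨(a, b), hx⟩, rfl⟩

/-- An edge with the same face on both sides would cancel modulo two; `faceOf_ne_faceOf_symm`
excludes this. -/
theorem vec_faceEdges (hG : ThreeConnected G) (hTG : T ≤ G) (hT : T.IsTree) (hM : M.Planar)
    (f : M.Face) : vec (M.faceEdges f) = coboundary M (Pi.single f 1) := by
  ext x
  by_cases hx : x ∈ G.edgeSet
  · obtain ⟨d, rfl⟩ := exists_dart_edge_eq hx
    have hne := faceOf_ne_faceOf_symm hG hTG hT hM d
    rw [vec_apply, coboundary_edge, Pi.single_apply, Pi.single_apply, mem_faceEdges]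
    by_cases h1 : M.faceOf d = f
    · have h2 : M.faceOf d.symm ≠ f := fun h => hne (h1.trans h.symm)
      simp [h1, h2]
    · simp [h1]
  · rw [(coboundary_mem_evenSpace M _).2 x hx, vec_apply, if_neg]
    rintro ⟨d, -, rfl⟩
    exact hx d.edge_mem

end Faces

/-! ### The inside of a fundamental cycle. -/

section Sides

variable {V : Type*} [Fintype V] {G T : SimpleGraph V} {M : Embedding G} {f₀ : M.Face}

/-- The set of faces inside the fundamental cycle of `e`, over `ℤ/2`. -/
noncomputable def side (T : SimpleGraph V) (M : Embedding G) (f₀ : M.Face) (e : Sym2 V) :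
    M.Face → ZMod 2 :=
  if h : ∃ g, coboundary M g = vec (fundCycle G T e) ∧ g f₀ = 0 then h.choose else 0

/-- A set of faces bounded by `C(e)` exists and may be changed by a constant to make it `0` on the
outer face, so the default value of `side` plays no role for non-tree edges. -/
theorem side_spec (hTG : T ≤ G) (hT : T.IsTree) (hM : M.Planar) (f₀ : M.Face) {e : Sym2 V}
    (he : NonTree G T e) :
    coboundary M (side T M f₀ e) = vec (fundCycle G T e) ∧ side T M f₀ e f₀ = 0 := by
  have h : ∃ g, coboundary M g = vec (fundCycle G T e) ∧ g f₀ = 0 := by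
    obtain ⟨g, hg⟩ := exists_coboundary_eq M hTG hT hM (vec_fundCycle_mem_evenSpace hTG hT he)
    refine ⟨g - fun _ => g f₀, ?_, sub_self _⟩
    rw [map_sub, coboundary_const, hg, sub_zero]
  rw [side, dif_pos h]
  exact h.choose_spec

theorem side_add_side_symm (hTG : T ≤ G) (hT : T.IsTree) (hM : M.Planar) (f₀ : M.Face)
    {e : Sym2 V} (he : NonTree G T e) (d : G.Dart) :
    side T M f₀ e (M.faceOf d) + side T M f₀ e (M.faceOf d.symm) =
      vec (fundCycle G T e) d.edge := by
  rw [← coboundary_edge, (side_spec hTG hT hM f₀ he).1]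

theorem side_symm_eq (hTG : T ≤ G) (hT : T.IsTree) (hM : M.Planar) (f₀ : M.Face)
    {e : Sym2 V} (he : NonTree G T e) {d : G.Dart} (hd : NonTree G T d.edge) (hde : d.edge ≠ e) :
    side T M f₀ e (M.faceOf d.symm) = side T M f₀ e (M.faceOf d) := by
  rw [eq_comm, eq_iff_coboundary_edge_eq_zero, (side_spec hTG hT hM f₀ he).1,
    vec_fundCycle_apply hTG hT he hd, if_neg hde]

theorem side_eq_of_edge_eq (hTG : T ≤ G) (hT : T.IsTree) (hM : M.Planar) (f₀ : M.Face)
    {e : Sym2 V} (he : NonTree G T e) {d d' : G.Dart} (hd : NonTree G T d.edge)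
    (hde : d.edge ≠ e) (hdd : d'.edge = d.edge) :
    side T M f₀ e (M.faceOf d') = side T M f₀ e (M.faceOf d) := by
  rcases (SimpleGraph.dart_edge_eq_iff d' d).1 hdd with rfl | rfl
  · rfl
  · exact side_symm_eq hTG hT hM f₀ he hd hde

/-- A set of faces that is not left across non-tree edges is empty or contains all faces. -/
theorem eq_of_nonTree (hTG : T ≤ G) (hT : T.IsTree) {w : M.Face → ZMod 2}
    (h : ∀ d : G.Dart, NonTree G T d.edge → w (M.faceOf d) = w (M.faceOf d.symm))
    (f f' : M.Face) : w f = w f' := by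
  refine eq_of_coboundary_eq_zero M (hT.connected.mono hTG) ?_ f f'
  refine eq_zero_of_nonTree_eq_zero hT.isAcyclic (coboundary_mem_evenSpace M w) fun x hx => ?_
  obtain ⟨d, rfl⟩ := exists_dart_edge_eq hx.1
  exact (eq_iff_coboundary_edge_eq_zero M w d).1 (h d hx)

/-- Steps across edges off `C(e)` preserve `side`. Conversely, the set reachable from `f₀` has a
boundary supported on `C(e)`, hence empty or all of `C(e)`, so it is the set of all faces or the
complement of `side`. -/
theorem inside_iff (hTG : T ≤ G) (hT : T.IsTree) (hM : M.Planar) {e : Sym2 V}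
    (he : NonTree G T e) (f : M.Face) :
    M.Inside f₀ (fundCycle G T e) f ↔ side T M f₀ e f = 1 := by
  obtain ⟨hs, hs₀⟩ := side_spec hTG hT hM f₀ he
  set step : M.Face → M.Face → Prop := fun g h =>
    ∃ d : G.Dart, d.edge ∉ fundCycle G T e ∧ M.faceOf d = g ∧ M.faceOf d.symm = h with hstep
  have hinv : ∀ f, Relation.ReflTransGen step f₀ f → side T M f₀ e f = 0 := by
    intro f hf
    induction hf with
    | refl => exact hs₀
    | tail _ hbc ih =>
      obtain ⟨d, hd, rfl, rfl⟩ := hbc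
      rw [← ih, eq_comm, eq_iff_coboundary_edge_eq_zero, hs, vec_apply, if_neg hd]
  constructor
  · intro hf
    by_contra hne
    have hf0 := (zmod_two_cases _).resolve_right hne
    let w : M.Face → ZMod 2 := fun f => if Relation.ReflTransGen step f₀ f then 1 else 0
    have hw₀ : w f₀ = 1 := if_pos Relation.ReflTransGen.refl
    have hwf : w f = 0 := if_neg hf
    have hw : ∀ x, NonTree G T x → x ≠ e → coboundary M w x = 0 := by
      intro x hx hxe
      obtain ⟨d, rfl⟩ := exists_dart_edge_eq hx.1
      have hdC : d.edge ∉ fundCycle G T e := by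
        intro h
        have := vec_fundCycle_apply hTG hT he hx
        rw [vec_apply, if_pos h, if_neg hxe] at this
        exact one_ne_zero this
      have hstep1 : step (M.faceOf d) (M.faceOf d.symm) := ⟨d, hdC, rfl, rfl⟩
      have hstep2 : step (M.faceOf d.symm) (M.faceOf d) :=
        ⟨d.symm, by rwa [d.edge_symm], rfl, by rw [d.symm_symm]⟩
      have h2 : Relation.ReflTransGen step f₀ (M.faceOf d) ↔
          Relation.ReflTransGen step f₀ (M.faceOf d.symm) :=
        ⟨fun h => h.tail hstep1, fun h => h.tail hstep2⟩
      refine (eq_iff_coboundary_edge_eq_zero M w d).1 ?_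
      simp only [w, h2]
    have hG : G.Connected := hT.connected.mono hTG
    rcases zmod_two_cases (coboundary M w e) with h0 | h1
    · have hz : coboundary M w = 0 := eq_zero_of_nonTree_eq_zero hT.isAcyclic
        (coboundary_mem_evenSpace M w) fun x hx => by
          by_cases hxe : x = e
          · rw [hxe, h0]
          · exact hw x hx hxe
      have := eq_of_coboundary_eq_zero M hG hz f f₀
      rw [hw₀, hwf] at this
      exact zero_ne_one this
    · have hz : coboundary M (w - side T M f₀ e) = 0 := by
        rw [map_sub, sub_eq_zero, hs]
        refine eq_of_eq_on_nonTree hT.isAcyclic (coboundary_mem_evenSpace M w)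
          (vec_fundCycle_mem_evenSpace hTG hT he) fun x hx => ?_
        rw [vec_fundCycle_apply hTG hT he hx]
        split_ifs with hxe
        · rw [hxe, h1]
        · exact hw x hx hxe
      have := eq_of_coboundary_eq_zero M hG hz f f₀
      rw [Pi.sub_apply, Pi.sub_apply, hw₀, hwf, hs₀, hf0, sub_zero, sub_zero] at this
      exact zero_ne_one this
  · intro hf hreach
    exact zero_ne_one ((hinv f hreach).symm.trans hf)

end Sides

/-! ### The order `≺` as geometric enclosure, and the inner faces. -/

section EnclosureOrder

variable {V : Type*} [Fintype V] {G T : SimpleGraph V} {M : Embedding G} {f₀ : M.Face}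

/-- Along a walk in the connected conflict graph, colour and side both flip at every step. -/
theorem bridge_colour_iff {u : V} {C : G.Walk u u} {e : Sym2 V} {g : M.Face → ZMod 2}
    (hG : ThreeConnected G) (hTG : T ≤ G) (hT : T.IsTree) (hM : M.Planar)
    (hC : IsFundCycle T e C) (hg : coboundary M g = vec {x | x ∈ C.edges})
    (c : (conflictGraph C).Coloring (Fin 2)) {B B' : Bridge C} {d d' : G.Dart}
    (hd : d.edge ∈ B.edges) (hd' : d'.edge ∈ B'.edges) :
    c B = c B' ↔ g (M.faceOf d) = g (M.faceOf d') := by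
  have htwo : ∀ {a b c : Fin 2}, a ≠ b → (a = c ↔ b ≠ c) := by decide
  have htwo' : ∀ {a b c : ZMod 2}, a ≠ b → (a = c ↔ b ≠ c) := by decide
  obtain ⟨w⟩ := conflictGraph_preconnected hG hC.1 B B'
  induction w generalizing d with
  | nil =>
    refine iff_of_true rfl (eq_of_mem_bridge_edges M (fun x hx => ?_) hd hd')
    rw [hg, vec_apply, if_neg]
    exact Bridge.notMem_cycle hx
  | @cons B L B' hadj w ih =>
    obtain ⟨p, q, -, hp, -⟩ := Bridge.exists_two_positions hG hC.1 L
    obtain ⟨l, -, hl⟩ := Bridge.exists_dart_of_mem_attachments hp.2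
    have h1 : g (M.faceOf d) ≠ g (M.faceOf l) :=
      ne_of_conflict hTG hT hM hC hg hadj.1 hadj.2 hd hl
    rw [htwo (c.valid hadj), htwo' h1]
    exact (ih hl hd').not

/-- Colouring each bridge by its side is proper by `ne_of_conflict`. Without a 2-colouring, `Prec`
would be empty for this cycle. -/
theorem exists_bridge_colouring {u : V} {C : G.Walk u u} {e : Sym2 V} {g : M.Face → ZMod 2}
    (hG : ThreeConnected G) (hTG : T ≤ G) (hT : T.IsTree) (hM : M.Planar)
    (hC : IsFundCycle T e C) (hg : coboundary M g = vec {x | x ∈ C.edges}) :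
    Nonempty ((conflictGraph C).Coloring (Fin 2)) := by
  have hex : ∀ B : Bridge C, ∃ d : G.Dart, d.edge ∈ B.edges := fun B => by
    obtain ⟨p, q, -, hp, -⟩ := Bridge.exists_two_positions hG hC.1 B
    obtain ⟨l, -, hl⟩ := Bridge.exists_dart_of_mem_attachments hp.2
    exact ⟨l, hl⟩
  choose d hd using hex
  exact ⟨SimpleGraph.Coloring.mk (fun B => (g (M.faceOf (d B)) : Fin 2)) fun {B L} h =>
    ne_of_conflict hTG hT hM hC hg h.1 h.2 (hd B) (hd L)⟩

theorem exists_outer_dart (hTG : T ≤ G) (hT : T.IsTree) {e₀ : Sym2 V} (he₀ : NonTree G T e₀)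
    (hf₀ : M.faceEdges f₀ = fundCycle G T e₀) : ∃ d₀ : G.Dart, M.faceOf d₀ = f₀ ∧ d₀.edge = e₀ := by
  have hmem : e₀ ∈ M.faceEdges f₀ := by
    have := vec_fundCycle_apply hTG hT he₀ he₀
    rw [if_pos rfl, vec_apply] at this
    rw [hf₀]
    by_contra h
    rw [if_neg h] at this
    exact zero_ne_one this
  exact hmem

/-- The order given by the conflict graphs is the enclosure of edges in fundamental cycles. -/
theorem prec_iff (hG : ThreeConnected G) (hTG : T ≤ G) (hT : T.IsTree) (hM : M.Planar)
    {e₀ : Sym2 V} (he₀ : NonTree G T e₀) (hf₀ : M.faceEdges f₀ = fundCycle G T e₀)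
    {e e' : Sym2 V} :
    Prec G T e₀ e' e ↔ NonTree G T e' ∧ NonTree G T e ∧ e' ≠ e ∧ e ≠ e₀ ∧
      ∀ d : G.Dart, d.edge = e' → side T M f₀ e (M.faceOf d) = 1 := by
  obtain ⟨d₀, hd₀f, hd₀⟩ := exists_outer_dart hTG hT he₀ hf₀
  constructor
  · rintro ⟨he', he, hne, u, C, hC, c, B₀, B₁, hB₀, hB₁, hc⟩
    have hee₀ : e ≠ e₀ := by
      rintro rfl
      exact Bridge.notMem_cycle hB₀ (mem_edges_of_isFundCycle hT.isAcyclic hC)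
    refine ⟨he', he, hne, hee₀, fun d hd => ?_⟩
    obtain ⟨hs, hs₀⟩ := side_spec hTG hT hM f₀ he
    rw [fundCycle_eq hT.isAcyclic hC] at hs
    have h1 := (bridge_colour_iff hG hTG hT hM hC hs c (hd₀.symm ▸ hB₀) (hd.symm ▸ hB₁)).not.1 hc
    rw [hd₀f, hs₀] at h1
    exact (zmod_two_cases _).resolve_left (Ne.symm h1)
  · rintro ⟨he', he, hne, hee₀, hd⟩
    obtain ⟨u, C, hC⟩ := exists_isFundCycle hTG hT he
    obtain ⟨hs, hs₀⟩ := side_spec hTG hT hM f₀ he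
    rw [fundCycle_eq hT.isAcyclic hC] at hs
    obtain ⟨c⟩ := exists_bridge_colouring hG hTG hT hM hC hs
    have hnot : ∀ x, NonTree G T x → x ≠ e → x ∉ C.edges := fun x hx hxe h =>
      (hC.2 x h).elim hx.2 hxe
    obtain ⟨B₀, hB₀⟩ := exists_bridge he₀.1 (hnot e₀ he₀ hee₀.symm)
    obtain ⟨B₁, hB₁⟩ := exists_bridge he'.1 (hnot e' he' hne)
    obtain ⟨d, rfl⟩ := exists_dart_edge_eq he'.1
    refine ⟨he', he, hne, u, C, hC, c, B₀, B₁, hB₀, hB₁, ?_⟩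
    rw [Ne, bridge_colour_iff hG hTG hT hM hC hs c (hd₀.symm ▸ hB₀) hB₁, hd₀f, hs₀, hd d rfl]
    exact zero_ne_one

theorem ne_outer_of_prec (hG : ThreeConnected G) (hTG : T ≤ G) (hT : T.IsTree) (hM : M.Planar)
    {e₀ : Sym2 V} (he₀ : NonTree G T e₀) (hf₀ : M.faceEdges f₀ = fundCycle G T e₀)
    {e e' : Sym2 V} (h : Prec G T e₀ e' e) : e' ≠ e₀ := by
  rintro rfl
  obtain ⟨d₀, hd₀f, hd₀⟩ := exists_outer_dart hTG hT he₀ hf₀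
  obtain ⟨-, he, -, -, h1⟩ := (prec_iff hG hTG hT hM he₀ hf₀).1 h
  have := h1 d₀ hd₀
  rw [hd₀f, (side_spec hTG hT hM f₀ he).2] at this
  exact zero_ne_one this

/-- If one face at `e'` is inside the fundamental cycle of `e`, then `e'` precedes `e`. -/
theorem prec_of_side (hG : ThreeConnected G) (hTG : T ≤ G) (hT : T.IsTree) (hM : M.Planar)
    {e₀ : Sym2 V} (he₀ : NonTree G T e₀) (hf₀ : M.faceEdges f₀ = fundCycle G T e₀)
    {e : Sym2 V} {d : G.Dart} (hd : NonTree G T d.edge) (he : NonTree G T e) (hne : d.edge ≠ e)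
    (hee₀ : e ≠ e₀) (hs : side T M f₀ e (M.faceOf d) = 1) : Prec G T e₀ d.edge e :=
  (prec_iff hG hTG hT hM he₀ hf₀).2 ⟨hd, he, hne, hee₀, fun _ hd' =>
    (side_eq_of_edge_eq hTG hT hM f₀ he hd hne hd').trans hs⟩

/-- Consider the faces outside both cycles. If each edge were inside the other cycle, crossing a
non-tree edge would never enter or leave this set; but it contains `f₀` and no face at `e`. -/
theorem not_prec_of_prec (hG : ThreeConnected G) (hTG : T ≤ G) (hT : T.IsTree) (hM : M.Planar)
    {e₀ : Sym2 V} (he₀ : NonTree G T e₀) (hf₀ : M.faceEdges f₀ = fundCycle G T e₀)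
    {e e' : Sym2 V} (h : Prec G T e₀ e' e) : ¬ Prec G T e₀ e e' := by
  intro h'
  obtain ⟨he', he, hne, -, h1⟩ := (prec_iff hG hTG hT hM he₀ hf₀).1 h
  obtain ⟨-, -, -, -, h1'⟩ := (prec_iff hG hTG hT hM he₀ hf₀).1 h'
  let w : M.Face → ZMod 2 := fun f => (1 + side T M f₀ e f) * (1 + side T M f₀ e' f)
  have h11 : (1 + 1 : ZMod 2) = 0 := rfl
  have hw : ∀ f f', w f = w f' := eq_of_nonTree hTG hT fun d hd => by
    by_cases h2 : d.edge = e
    · have h3 := h1' d h2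
      have h4 := h1' d.symm (d.edge_symm.trans h2)
      simp only [w, h3, h4, h11, mul_zero]
    · by_cases h5 : d.edge = e'
      · have h3 := h1 d h5
        have h4 := h1 d.symm (d.edge_symm.trans h5)
        simp only [w, h3, h4, h11, zero_mul]
      · simp only [w, side_symm_eq hTG hT hM f₀ he hd h2, side_symm_eq hTG hT hM f₀ he' hd h5]
  obtain ⟨d, hd⟩ := exists_dart_edge_eq he.1
  have h2 := hw (M.faceOf d) f₀
  simp only [w, h1' d hd, (side_spec hTG hT hM f₀ he).2, (side_spec hTG hT hM f₀ he').2, h11,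
    mul_zero, add_zero, mul_one] at h2
  exact zero_ne_one h2

/-- The faces inside `C(e')` but outside `C(e)` form a set that no non-tree edge leaves: faces at
`e'` are inside `C(e)`, and by asymmetry faces at `e` are outside `C(e')`. As `f₀` is not in this
set, it is empty. -/
theorem side_le_of_prec (hG : ThreeConnected G) (hTG : T ≤ G) (hT : T.IsTree) (hM : M.Planar)
    {e₀ : Sym2 V} (he₀ : NonTree G T e₀) (hf₀ : M.faceEdges f₀ = fundCycle G T e₀)
    {e e' : Sym2 V} (h : Prec G T e₀ e' e) {f : M.Face}
    (hf : side T M f₀ e' f = 1) : side T M f₀ e f = 1 := by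
  have hne₀ := ne_outer_of_prec hG hTG hT hM he₀ hf₀ h
  have hnot := not_prec_of_prec hG hTG hT hM he₀ hf₀ h
  obtain ⟨he', he, hne, -, h1⟩ := (prec_iff hG hTG hT hM he₀ hf₀).1 h
  let w : M.Face → ZMod 2 := fun f => (1 + side T M f₀ e f) * side T M f₀ e' f
  have h11 : (1 + 1 : ZMod 2) = 0 := rfl
  have hw : ∀ f f', w f = w f' := eq_of_nonTree hTG hT fun d hd => by
    by_cases h2 : d.edge = e
    · have hde' : d.edge ≠ e' := fun h => hne (h.symm.trans h2)
      have h3 : side T M f₀ e' (M.faceOf d) = 0 := (zmod_two_cases _).resolve_right fun h3 =>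
        hnot (h2 ▸ prec_of_side hG hTG hT hM he₀ hf₀ hd he' hde' hne₀ h3)
      simp only [w, side_symm_eq hTG hT hM f₀ he' hd hde', h3, mul_zero]
    · by_cases h5 : d.edge = e'
      · have h3 := h1 d h5
        have h4 := h1 d.symm (d.edge_symm.trans h5)
        simp only [w, h3, h4, h11, zero_mul]
      · simp only [w, side_symm_eq hTG hT hM f₀ he hd h2, side_symm_eq hTG hT hM f₀ he' hd h5]
  have h2 := hw f f₀
  simp only [w, hf, (side_spec hTG hT hM f₀ he').2, mul_zero, mul_one] at h2
  exact (zmod_two_cases _).resolve_left fun h3 => by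
    rw [h3, add_zero] at h2
    exact one_ne_zero h2

/-- The edge `e` has exactly one face inside its fundamental cycle. -/
theorem existsUnique_innerFace (hTG : T ≤ G) (hT : T.IsTree) (hM : M.Planar) {e : Sym2 V}
    (he : NonTree G T e) : ∃! f : M.Face, IsInnerFace T M f₀ e f := by
  obtain ⟨d, rfl⟩ := exists_dart_edge_eq he.1
  have hsum := side_add_side_symm hTG hT hM f₀ he d
  rw [vec_fundCycle_apply hTG hT he he, if_pos rfl] at hsum
  have key : ∀ d' : G.Dart, d'.edge = d.edge → side T M f₀ d.edge (M.faceOf d') = 1 →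
      side T M f₀ d.edge (M.faceOf d'.symm) = 0 →
      ∃! f : M.Face, IsInnerFace T M f₀ d.edge f := by
    intro d' hd' h1 h0
    refine ⟨M.faceOf d', ⟨⟨d', rfl, hd'⟩, (inside_iff hTG hT hM he _).2 h1⟩, ?_⟩
    rintro f ⟨hf, hin⟩
    rw [inside_iff hTG hT hM he] at hin
    rw [← hd', mem_faceEdges] at hf
    rcases hf with rfl | rfl
    · rfl
    · exact absurd (h0.symm.trans hin) zero_ne_one
  rcases zmod_two_cases (side T M f₀ d.edge (M.faceOf d)) with h | h
  · refine key d.symm d.edge_symm ?_ (by rwa [d.symm_symm])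
    simpa [h] using hsum
  · refine key d rfl h ?_
    rw [h] at hsum
    simpa using hsum

/-- The non-tree edges of the inner face at `e` are `e` and its immediate predecessors. -/
theorem mem_faceEdges_innerFace_iff (hG : ThreeConnected G) (hTG : T ≤ G) (hT : T.IsTree)
    (hM : M.Planar) {e₀ : Sym2 V} (he₀ : NonTree G T e₀) (hf₀ : M.faceEdges f₀ = fundCycle G T e₀)
    {e : Sym2 V} (he : NonTree G T e) (hee₀ : e ≠ e₀) {f : M.Face}
    (hf : IsInnerFace T M f₀ e f) {x : Sym2 V} (hx : NonTree G T x) :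
    x ∈ M.faceEdges f ↔ x ∈ predecessors G T e₀ e ∪ {e} := by
  obtain ⟨hef, hin⟩ := hf
  rw [inside_iff hTG hT hM he] at hin
  by_cases hxe : x = e
  · subst hxe
    exact iff_of_true hef (Or.inr rfl)
  have hprec : ∀ {y}, NonTree G T y → y ≠ e → y ∈ M.faceEdges f → Prec G T e₀ y e := by
    rintro y hy hye ⟨d, rfl, rfl⟩
    exact prec_of_side hG hTG hT hM he₀ hf₀ hy he hye hee₀ hin
  constructor
  · intro hxf
    refine Or.inl ⟨hx, hxe, hprec hx hxe hxf, ?_⟩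
    -- As a face at `x`, the face `f` is inside `C(y)`. It is also a face at `e`, so `e ≺ y`,
    -- against asymmetry.
    rintro ⟨y, hxy, hye⟩
    obtain ⟨-, hy, -, hy₀, h1⟩ := (prec_iff hG hTG hT hM he₀ hf₀).1 hxy
    have hne := ((prec_iff hG hTG hT hM he₀ hf₀).1 hye).2.2.1
    obtain ⟨d, rfl, rfl⟩ := hxf
    obtain ⟨d', hd', rfl⟩ := hef
    exact not_prec_of_prec hG hTG hT hM he₀ hf₀ hye
      (prec_of_side hG hTG hT hM he₀ hf₀ he hy hne.symm hy₀ (by rw [hd']; exact h1 d rfl))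
  · rintro (⟨-, -, hxprec, hno⟩ | h)
    swap
    · exact absurd h hxe
    by_contra hxf
    obtain ⟨d, rfl⟩ := exists_dart_edge_eq hx.1
    have hdf : M.faceOf d ≠ f := fun h => hxf (mem_faceEdges.2 (Or.inl h))
    let N : Finset (Sym2 V) :=
      Finset.univ.filter fun y => NonTree G T y ∧ y ≠ e ∧ y ∈ M.faceEdges f
    -- The single face `f` is the sum of the insides of the fundamental cycles of its non-tree
    -- edges: boundaries agree on non-tree edges, and both sides vanish at `f₀`. At a face of `x`,
    -- which is not `f` but is inside `C(e)`, some other summand must be `1`; this gives `x ≺ y ≺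
    -- e`.
    let k : M.Face → ZMod 2 := Pi.single f 1 - (side T M f₀ e + ∑ y ∈ N, side T M f₀ y)
    have hk : coboundary M k = 0 := by
      rw [map_sub, sub_eq_zero, map_add, map_sum, (side_spec hTG hT hM f₀ he).1,
        ← vec_faceEdges hG hTG hT hM]
      have hN : ∑ y ∈ N, coboundary M (side T M f₀ y) = ∑ y ∈ N, vec (fundCycle G T y) :=
        Finset.sum_congr rfl fun y hy =>
          (side_spec hTG hT hM f₀ (Finset.mem_filter.1 hy).2.1).1
      rw [hN]
      refine eq_of_eq_on_nonTree (G := G) hT.isAcyclic ?_ ?_ fun y hy => ?_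
      · rw [vec_faceEdges hG hTG hT hM]
        exact coboundary_mem_evenSpace M _
      · exact (evenSpace G).add_mem (vec_fundCycle_mem_evenSpace hTG hT he)
          ((evenSpace G).sum_mem fun y hy =>
            vec_fundCycle_mem_evenSpace hTG hT (Finset.mem_filter.1 hy).2.1)
      · have hsum : (∑ z ∈ N, vec (fundCycle G T z)) y = if y ∈ N then 1 else 0 := by
          rw [Finset.sum_apply, Finset.sum_congr rfl fun z hz =>
            vec_fundCycle_apply hTG hT (Finset.mem_filter.1 hz).2.1 hy, Finset.sum_ite_eq]
        rw [Pi.add_apply, hsum, vec_fundCycle_apply hTG hT he hy, vec_apply]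
        by_cases hye : y = e
        · subst hye
          rw [if_pos hef, if_pos rfl, if_neg (fun h => (Finset.mem_filter.1 h).2.2.1 rfl),
            add_zero]
        · have : y ∈ N ↔ y ∈ M.faceEdges f := by simp [N, hy, hye]
          simp only [this, if_neg hye, zero_add]
    have hN₀ : ∀ y ∈ N, side T M f₀ y f₀ = 0 := fun y hy =>
      (side_spec hTG hT hM f₀ (Finset.mem_filter.1 hy).2.1).2
    have he₀f := (side_spec hTG hT hM f₀ he).2
    have hff₀ : f₀ ≠ f := fun h => zero_ne_one (he₀f.symm.trans (h ▸ hin))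
    have hkeq := eq_of_coboundary_eq_zero M (hT.connected.mono hTG) hk (M.faceOf d) f₀
    have hde := ((prec_iff hG hTG hT hM he₀ hf₀).1 hxprec).2.2.2.2 d rfl
    simp only [k, Pi.sub_apply, Pi.add_apply, Finset.sum_apply, Pi.single_apply, if_neg hdf,
      if_neg hff₀, hde, he₀f, Finset.sum_eq_zero hN₀] at hkeq
    have hne : ∑ y ∈ N, side T M f₀ y (M.faceOf d) ≠ 0 := by
      intro h
      rw [h] at hkeq
      simp at hkeq
    obtain ⟨y, hyN, hy⟩ := Finset.exists_ne_zero_of_sum_ne_zero hne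
    obtain ⟨-, hyT, hye, hyf⟩ := Finset.mem_filter.1 hyN
    have hyprec := hprec hyT hye hyf
    refine hno ⟨y, prec_of_side hG hTG hT hM he₀ hf₀ hx hyT (fun h => hxf (h ▸ hyf))
      (ne_outer_of_prec hG hTG hT hM he₀ hf₀ hyprec) ((zmod_two_cases _).resolve_left hy), hyprec⟩

theorem vec_faceEdges_eq_cycleSum (hG : ThreeConnected G) (hTG : T ≤ G) (hT : T.IsTree)
    (hM : M.Planar) {e₀ : Sym2 V} (he₀ : NonTree G T e₀) (hf₀ : M.faceEdges f₀ = fundCycle G T e₀)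
    {e : Sym2 V} (he : NonTree G T e) (hee₀ : e ≠ e₀) {f : M.Face}
    (hf : IsInnerFace T M f₀ e f) : vec (M.faceEdges f) = cycleSum G T e₀ e := by
  have hN : ∀ y ∈ Finset.univ.filter (· ∈ predecessors G T e₀ e ∪ {e}), NonTree G T y := by
    intro y hy
    rcases (Finset.mem_filter.1 hy).2 with h | h
    · exact h.1
    · exact h ▸ he
  rw [cycleSum]
  refine eq_of_eq_on_nonTree (G := G) hT.isAcyclic ?_ ?_ fun y hy => ?_
  · rw [vec_faceEdges hG hTG hT hM]
    exact coboundary_mem_evenSpace M _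
  · exact (evenSpace G).sum_mem fun y hy => vec_fundCycle_mem_evenSpace hTG hT (hN y hy)
  · rw [Finset.sum_apply, Finset.sum_congr rfl fun z hz =>
      vec_fundCycle_apply hTG hT (hN z hz) hy, Finset.sum_ite_eq, vec_apply]
    simp only [mem_faceEdges_innerFace_iff hG hTG hT hM he₀ hf₀ he hee₀ hf hy, Finset.mem_filter,
      Finset.mem_univ, true_and]

end EnclosureOrder

/-! ### The two bases of the cycle space. -/

section Bases

variable {V : Type*} [Fintype V] {G T : SimpleGraph V} {M : Embedding G} {f₀ : M.Face}

theorem vec_fundCycle_mem_cycleSpace (hTG : T ≤ G) (hT : T.IsTree) {e : Sym2 V}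
    (he : NonTree G T e) : vec (fundCycle G T e) ∈ cycleSpace G := by
  obtain ⟨u, C, hC⟩ := exists_isFundCycle hTG hT he
  rw [fundCycle_eq hT.isAcyclic hC]
  exact Submodule.subset_span ⟨u, C, hC.1, rfl⟩

/-- Restricted to the non-tree edges, the fundamental cycles are the standard basis, and an even
subgraph is recovered from its values there. -/
theorem isCycleBasis_fundCycle (hTG : T ≤ G) (hT : T.IsTree) :
    IsCycleBasis G (fun e : {e : Sym2 V // NonTree G T e} => vec (fundCycle G T e)) := by
  constructor
  · refine LinearIndependent.of_comp
      (LinearMap.funLeft (ZMod 2) (ZMod 2) (Subtype.val : {e : Sym2 V // NonTree G T e} → Sym2 V)) ?_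
    convert (Pi.basisFun (ZMod 2) {e : Sym2 V // NonTree G T e}).linearIndependent using 1
    ext e x
    rw [Function.comp_apply, LinearMap.funLeft_apply, vec_fundCycle_apply hTG hT e.2 x.2,
      Pi.basisFun_apply, Pi.single_apply]
    simp only [Subtype.ext_iff]
  · refine le_antisymm ?_ (cycleSpace_le_evenSpace.trans fun z hz => ?_)
    · rw [Submodule.span_le]
      rintro _ ⟨e, rfl⟩
      exact vec_fundCycle_mem_cycleSpace hTG hT e.2
    · have : z = ∑ e : {e : Sym2 V // NonTree G T e}, z e • vec (fundCycle G T e) := by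
        refine eq_of_eq_on_nonTree hT.isAcyclic hz ((evenSpace G).sum_mem fun e _ =>
          (evenSpace G).smul_mem _ (vec_fundCycle_mem_evenSpace hTG hT e.2)) fun x hx => ?_
        rw [Finset.sum_apply, Finset.sum_eq_single (⟨x, hx⟩ : {e : Sym2 V // NonTree G T e})]
        · rw [Pi.smul_apply, vec_fundCycle_apply hTG hT hx hx, if_pos rfl, smul_eq_mul, mul_one]
        · intro e _ hne
          rw [Pi.smul_apply, vec_fundCycle_apply hTG hT e.2 hx, if_neg, smul_zero]
          exact fun h => hne (Subtype.ext h.symm)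
        · exact fun h => absurd (Finset.mem_univ _) h
      rw [this]
      exact Submodule.sum_mem _ fun e _ => Submodule.smul_mem _ _ (Submodule.subset_span ⟨e, rfl⟩)

theorem isCycleBasis_cycleSum (hG : ThreeConnected G) (hTG : T ≤ G) (hT : T.IsTree)
    (hM : M.Planar) {e₀ : Sym2 V} (he₀ : NonTree G T e₀)
    (hf₀ : M.faceEdges f₀ = fundCycle G T e₀) :
    IsCycleBasis G (fun e : {e : Sym2 V // NonTree G T e} =>
      if (e : Sym2 V) = e₀ then vec (M.faceEdges f₀) else cycleSum G T e₀ e) := by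
  set b : {e : Sym2 V // NonTree G T e} → Sym2 V → ZMod 2 := fun e =>
    if (e : Sym2 V) = e₀ then vec (M.faceEdges f₀) else cycleSum G T e₀ e with hb
  obtain ⟨hli, hspan⟩ := isCycleBasis_fundCycle hTG hT
  -- Induction on the number of faces inside `C(e)`: `F(e)` is `C(e)` plus cycles of predecessors.
  -- These enclose strictly fewer faces, as their insides are contained in that of `C(e)` and omit
  -- the inner face at `e`.
  have hmem : ∀ n : ℕ, ∀ e, NonTree G T e →
      (Finset.univ.filter fun f => side T M f₀ e f = 1).card < n →
      vec (fundCycle G T e) ∈ Submodule.span (ZMod 2) (Set.range b) := by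
    intro n
    induction n with
    | zero => intro e _ h; omega
    | succ n ih =>
      intro e he hcard
      by_cases hee₀ : e = e₀
      · exact Submodule.subset_span ⟨⟨e, he⟩, by simp only [hb, hf₀, hee₀, if_true]⟩
      have hsum : cycleSum G T e₀ e ∈ Submodule.span (ZMod 2) (Set.range b) :=
        Submodule.subset_span ⟨⟨e, he⟩, by simp only [hb, if_neg hee₀]⟩
      have hself : e ∈ Finset.univ.filter (· ∈ predecessors G T e₀ e ∪ {e}) :=
        Finset.mem_filter.2 ⟨Finset.mem_univ _, Or.inr rfl⟩
      rw [cycleSum, ← Finset.add_sum_erase _ _ hself] at hsum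
      refine (Submodule.add_mem_iff_left _ (Submodule.sum_mem _ fun y hy => ?_)).1 hsum
      obtain ⟨hye, hy⟩ := Finset.mem_erase.1 hy
      obtain ⟨hyT, -, hprec, -⟩ := (Finset.mem_filter.1 hy).2.resolve_right hye
      refine ih y hyT (lt_of_lt_of_le (Finset.card_lt_card ?_) (Nat.lt_succ_iff.1 hcard))
      rw [Finset.ssubset_iff_of_subset]
      · obtain ⟨f, ⟨⟨d, rfl, rfl⟩, hin⟩, -⟩ :=
          (existsUnique_innerFace hTG hT hM he : ∃! f, IsInnerFace T M f₀ e f)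
        rw [inside_iff hTG hT hM he] at hin
        refine ⟨M.faceOf d, by simpa using hin, fun h => ?_⟩
        exact not_prec_of_prec hG hTG hT hM he₀ hf₀ hprec
          (prec_of_side hG hTG hT hM he₀ hf₀ he hyT (Ne.symm hye)
            (ne_outer_of_prec hG hTG hT hM he₀ hf₀ hprec) (Finset.mem_filter.1 h).2)
      · intro f hf
        rw [Finset.mem_filter] at hf ⊢
        exact ⟨hf.1, side_le_of_prec hG hTG hT hM he₀ hf₀ hprec hf.2⟩
  have hspan' : Submodule.span (ZMod 2) (Set.range b) = cycleSpace G := by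
    refine le_antisymm ?_ ?_
    · rw [Submodule.span_le]
      rintro _ ⟨e, rfl⟩
      simp only [hb]
      split_ifs with h
      · rw [hf₀]
        exact vec_fundCycle_mem_cycleSpace hTG hT he₀
      · refine Submodule.sum_mem _ fun y hy => vec_fundCycle_mem_cycleSpace hTG hT ?_
        rcases (Finset.mem_filter.1 hy).2 with h | h
        · exact h.1
        · exact h ▸ e.2
    · rw [← hspan, Submodule.span_le]
      rintro _ ⟨e, rfl⟩
      exact hmem _ e e.2 (Nat.lt_succ_self _)
  refine ⟨?_, hspan'⟩
  -- A spanning family with as many members as the basis of fundamental cycles is independent.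
  rw [linearIndependent_iff_card_eq_finrank_span, Set.finrank, hspan', ← hspan,
    finrank_span_eq_card hli]

end Bases

end PlanarBasis

open Classical in
theorem mainTheorem5 {V : Type*} [Fintype V] (G : SimpleGraph V)
    (hG : PlanarBasis.ThreeConnected G)
    (M : PlanarBasis.Embedding G) (hM : M.Planar)
    (T : SimpleGraph V) (hTG : T ≤ G) (hT : T.IsTree)
    (e₀ : Sym2 V) (he₀ : PlanarBasis.NonTree G T e₀)
    (f₀ : M.Face) (hf₀ : M.faceEdges f₀ = PlanarBasis.fundCycle G T e₀) :
    (∀ e : Sym2 V, PlanarBasis.NonTree G T e → e ≠ e₀ →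
      (∃! f : M.Face, PlanarBasis.IsInnerFace T M f₀ e f) ∧
      ∀ f : M.Face, PlanarBasis.IsInnerFace T M f₀ e f →
        PlanarBasis.vec (M.faceEdges f) = PlanarBasis.cycleSum G T e₀ e) ∧
    PlanarBasis.IsCycleBasis G
      (fun e : {e : Sym2 V // PlanarBasis.NonTree G T e} =>
        PlanarBasis.vec (PlanarBasis.fundCycle G T e)) ∧
    PlanarBasis.IsCycleBasis G
      (fun e : {e : Sym2 V // PlanarBasis.NonTree G T e} =>
        if (e : Sym2 V) = e₀ then PlanarBasis.vec (M.faceEdges f₀)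
        else PlanarBasis.cycleSum G T e₀ e) :=
  ⟨fun _ he hee₀ => ⟨PlanarBasis.existsUnique_innerFace hTG hT hM he, fun _ hf =>
      PlanarBasis.vec_faceEdges_eq_cycleSum hG hTG hT hM he₀ hf₀ he hee₀ hf⟩,
    PlanarBasis.isCycleBasis_fundCycle hTG hT,
    PlanarBasis.isCycleBasis_cycleSum hG hTG hT hM he₀ hf₀⟩
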